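/- Let $n\ge 4$ and $d\ge 3$ be integers, $s=d/2$, and $0<\epsilon\le 7/16$. For a $d$-regular graph $G$ on $n$ vertices (it has $ns$ edges) and coefficients $J_{ij},h_i,t_i\in[-1,1]$ let $$H_{\text{target}}=\sum_{ij\in G}J_{ij}Z_iZ_j+\sum_i (h_iZ_i+t_iX_i)\quad\text{on } n \text{ qubits.}$$ Let $J\in(0,1)$. Couple each qubit $i$ to one further qubit, its coupler, with $H_m=\sqrt{1-J^2}\,X_{qc}$ and $I_m=JZ_{qc}$, so that the bare Hamiltonian is $$H_0=\sum_i\Big(\sqrt{1-J^2}\,X_{qc,i}+J\,Z_iZ_{qc,i}\Big),$$ and let $P$ be the projector onto its ground space. For $b=0,1$ (i.e. $Z_i=\pm1$) the lowest eigenvalue of $\sqrt{1-J^2}X\pm JZ$ is $-1$; let $g_b$ be a unit ground vector and $\rho_b=|g_b\rangle\langle g_b|$, with the (real) phases chosen so that $\langle g_0|g_1\rangle>0$. (1) One has $\chi:=\operatorname{tr}(\rho_1Z)=J$, $F:=\langle g_0|g_1\rangle=\sqrt{1-J^2}$, and $\|PZ_{qc,i}\|=1$ for every $i$. The ground energy of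 $H_0$ is $-n$, the rest of its spectrum lies in $[-n+2,\infty)$, and the vectors $\bigotimes_i|m_i\rangle|g_{m_i}\rangle$, $m\in\{0,1\}^n$, are an orthonormal basis of the range of $P$ (the logical basis). Let $W$ be the isometry from $n$ qubits onto the range of $P$ that sends $|m\rangle$ to the logical basis vector of $m$. (2) Put $\Delta_V=0.95$, $$\alpha=\frac{s\epsilon\,\Delta_V}{3\cdot7n\,(1+1/\sqrt{1-J^2}+sJ^{-2})^2},\qquad \delta_n(J)=\frac{(s\epsilon)^2\,\Delta_V\,(3+\sqrt{1-J^2}+sJ^2)^{-1}}{12\cdot 7n\,(1+1/\sqrt{1-J^2}+sJ^{-2})^2},$$ and let the implemented Hamiltonian be $H_0+V$ with $$V=\sum_i\Big((\alpha h_i+\delta h_i)Z_i+(\alpha F^{-1}t_i+\delta t_i)X_i+\delta J_i\,Z_iZ_{qc,i}+\delta\Omega_i\,X_{qc,i}\Big)+\sum_{ij\in G}\Big(\frac{\alpha J_{ij}}{\chi^2}+\delta f_{ij}\Big)Z_{qc,i}Z_{qc,j},$$ where all the control errors $\delta h_i,\delta t_i,\delta J_i,\delta\Omega_i,\delta f_{ij}$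 are arbitrary real numbers of absolute value at most $\delta$. If $\delta\le\delta_n(J)$, then for every such $G$, every choice of coefficients and all such control errors: (a) there is $v$ with $\pm V\le v\,(1+H_0+n)$ and $\Delta_V\le \Delta-v(1+\Delta)$ for $\Delta=1$, and the spectrum of $H_0+V$ lies in $[-n-v,-n+v]\cup[-n+\Delta_V,\infty)$; (b) let $P'$ be the spectral projector of $H_0+V$ for the interval $(-\infty,-n+\Delta_V/2)$. The Schrieffer–Wolff rotation $U=\sqrt{(2P-1)(2P'-1)}$ (the principal root, a unitary whose eigenvalues have positive real part) exists, $UP'U^\dagger=P$, and $U(H_0+V)U^\dagger$ commutes with $P$; (c) the effective Hamiltonian $H_{\text{eff}}=W^\dagger U(H_0+V+n)U^\dagger W$, i.e. the low-energy block in the logical basis, satisfies in operator norm $$\|H_{\text{eff}}-\alpha H_{\text{target}}\|\le\alpha\,\epsilon\,n s .$$ (3) The maximum of $\delta_n(J)$ over $J\in(0,1)$ is attained at a $J$ that depends only on $s$, and there $\delta_n(J)=C\epsilon^2/n$ with $C>0$ depending only on $s$. Hence the gadget with this $J$ reproduces $H_{\text{target}}$ to error $\epsilon ns$, in the sense of (2),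 whenever $$\delta\le\max_J\frac{(s\epsilon)^2\cdot0.95\,(3+\sqrt{1-J^2}+sJ^2)^{-1}}{12\cdot 7n\,(1+1/\sqrt{1-J^2}+sJ^{-2})^2}=O(1/n).$$ -/

import Mathlib

open scoped Matrix Kronecker ComplexOrder Matrix.Norms.L2Operator

noncomputable section

namespace QubitCoupler

/-- The Pauli matrix `X`. -/
def pauliX : Matrix (Fin 2) (Fin 2) ℂ := !![0, 1; 1, 0]

/-- The Pauli matrix `Z`. -/
def pauliZ : Matrix (Fin 2) (Fin 2) ℂ := !![1, 0; 0, -1]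

/-- The operator acting as `A` on site `i` of an `n`-site system (local basis `κ`) and as the
identity on all the other sites. -/
def siteOp {n : ℕ} {κ : Type} [DecidableEq κ] (i : Fin n) (A : Matrix κ κ ℂ) :
    Matrix (Fin n → κ) (Fin n → κ) ℂ :=
  Matrix.of fun x y => if ∀ j, j ≠ i → x j = y j then A (x i) (y i) else 0

/-- The spectral projector of a Hermitian matrix `A` onto the eigenvalues in `S`: the function
`1_S` applied to `A`. -/
def spectralProj {ι : Type} [Fintype ι] [DecidableEq ι] (A : Matrix ι ι ℂ) (S : Set ℝ) :
    Matrix ι ι ℂ :=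
  cfc (S.indicator (fun _ => (1 : ℝ))) A

/-- The target Hamiltonian: the transverse field Ising model on the graph `G`,
`∑_{ij ∈ G} J_ij Z_i Z_j + ∑_i (h_i Z_i + t_i X_i)`. Each edge is counted once, as a pair
`i < j`. -/
def targetHam {n : ℕ} (G : SimpleGraph (Fin n)) [DecidableRel G.Adj]
    (Jt : Fin n → Fin n → ℝ) (h t : Fin n → ℝ) :
    Matrix (Fin n → Fin 2) (Fin n → Fin 2) ℂ :=
  (∑ i, ∑ j, if i < j ∧ G.Adj i j then Jt i j • (siteOp i pauliZ * siteOp j pauliZ) else 0) +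
    ∑ i, (h i • siteOp i pauliZ + t i • siteOp i pauliX)

/-- The operator `A` of the qubit at one site of the gadget. A site is a qubit (first factor)
with its coupler (second factor). -/
def qubitOp (A : Matrix (Fin 2) (Fin 2) ℂ) : Matrix (Fin 2 × Fin 2) (Fin 2 × Fin 2) ℂ :=
  A ⊗ₖ (1 : Matrix (Fin 2) (Fin 2) ℂ)

/-- The operator `A` of the coupler at one site of the gadget. -/
def couplerOp (A : Matrix (Fin 2) (Fin 2) ℂ) : Matrix (Fin 2 × Fin 2) (Fin 2 × Fin 2) ℂ :=
  (1 : Matrix (Fin 2) (Fin 2) ℂ) ⊗ₖ A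

/-- The coupler Hamiltonian `H_m = √(1 - J²) X`. -/
def couplerHm (J : ℝ) : Matrix (Fin 2) (Fin 2) ℂ := √(1 - J ^ 2) • pauliX

/-- The operator `I_m = J Z` through which the coupler interacts with its qubit. -/
def couplerIm (J : ℝ) : Matrix (Fin 2) (Fin 2) ℂ := J • pauliZ

/-- The bare Hamiltonian `H₀ = ∑_i (H_{m,i} + Z_i I_{m,i})` of `n` qubits and `n` couplers. -/
def bareHam (n : ℕ) (J : ℝ) :
    Matrix (Fin n → Fin 2 × Fin 2) (Fin n → Fin 2 × Fin 2) ℂ :=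
  ∑ i, siteOp i (couplerOp (couplerHm J) + qubitOp pauliZ * couplerOp (couplerIm J))

/-- The perturbation
`V = ∑_i (h_i^c Z_i + t_i^c X_i + δJ_i Z_i Z_{qc,i} + δΩ_i X_{qc,i})
  + ∑_{ij ∈ G} f_ij Z_{qc,i} Z_{qc,j}`. -/
def perturbation {n : ℕ} (G : SimpleGraph (Fin n)) [DecidableRel G.Adj]
    (hc tc : Fin n → ℝ) (f : Fin n → Fin n → ℝ) (δJ δΩ : Fin n → ℝ) :
    Matrix (Fin n → Fin 2 × Fin 2) (Fin n → Fin 2 × Fin 2) ℂ :=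
  (∑ i, (hc i • siteOp i (qubitOp pauliZ) + tc i • siteOp i (qubitOp pauliX) +
      δJ i • siteOp i (qubitOp pauliZ * couplerOp pauliZ) +
      δΩ i • siteOp i (couplerOp pauliX))) +
    ∑ i, ∑ j, if i < j ∧ G.Adj i j then
      f i j • (siteOp i (couplerOp pauliZ) * siteOp j (couplerOp pauliZ)) else 0

/-- The `Z`-eigenvalue `±1` of the qubit basis state `b = 0, 1`. -/
def zSign (b : Fin 2) : ℝ := if b = 0 then 1 else -1

/-- The state `ρ_b` of a coupler whose qubit is in the basis state `b`: the projector onto the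
eigenspace of `H_m ± I_m` for its lowest eigenvalue `-1`. -/
def couplerState (J : ℝ) (b : Fin 2) : Matrix (Fin 2) (Fin 2) ℂ :=
  spectralProj (couplerHm J + zSign b • couplerIm J) {-1}

/-- The ground vector `g_b` of `H_m ± I_m`, with the phases for which `⟨g_0|g_1⟩ > 0`. -/
def couplerGround (J : ℝ) (b : Fin 2) : Fin 2 → ℂ :=
  ![((√((1 - zSign b * J) / 2) : ℝ) : ℂ), ((-√((1 + zSign b * J) / 2) : ℝ) : ℂ)]

/-- The response `χ = tr ρ_1 Z_qc` of a coupler to its qubit. -/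
def chi (J : ℝ) : ℂ := (couplerState J 1 * pauliZ).trace

/-- The overlap `F = ⟨g_0|g_1⟩` of the two coupler ground states. -/
def overlap (J : ℝ) : ℂ := star (couplerGround J 0) ⬝ᵥ couplerGround J 1

/-- The projector `P` onto the ground space of the bare Hamiltonian, whose lowest eigenvalue
is `-n`. -/
def groundProj (n : ℕ) (J : ℝ) :
    Matrix (Fin n → Fin 2 × Fin 2) (Fin n → Fin 2 × Fin 2) ℂ :=
  spectralProj (bareHam n J) {-(n : ℝ)}

/-- The logical basis: the column `m` is the product state `⊗_i |m_i⟩|g_{m_i}⟩`. -/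
def logicalBasis (n : ℕ) (J : ℝ) : Matrix (Fin n → Fin 2 × Fin 2) (Fin n → Fin 2) ℂ :=
  Matrix.of fun x m => ∏ i, if (x i).1 = m i then couplerGround J (m i) (x i).2 else 0

/-- `U` is the Schrieffer-Wolff rotation `√((2P - 1)(2P' - 1))` taking `P'` to `P`. The root is
the principal one: the unitary root whose eigenvalues have positive real part, of which there
is at most one. -/
def IsSchriefferWolff {ι : Type} [Fintype ι] [DecidableEq ι] (P P' U : Matrix ι ι ℂ) : Prop :=
  U ∈ Matrix.unitaryGroup ι ℂ ∧ U * U = (2 * P - 1) * (2 * P' - 1) ∧ (U + Uᴴ).PosDef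

/-- The adjusted gap `Δ_V` used in the construction. -/
def adjGap : ℝ := 0.95

/-- The reduction factor `α = s ε Δ_V / (3 · 7 n (1 + 1/√(1-J²) + s J⁻²)²)`. -/
def reductionFactor (n : ℕ) (s ε J : ℝ) : ℝ :=
  s * ε * adjGap / (3 * 7 * n * (1 + (√(1 - J ^ 2))⁻¹ + s * (J ^ 2)⁻¹) ^ 2)

/-- The admissible control error at a given `J`. -/
def controlBound (n : ℕ) (s ε J : ℝ) : ℝ :=
  (s * ε) ^ 2 * adjGap * (3 + √(1 - J ^ 2) + s * J ^ 2)⁻¹ /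
    (12 * 7 * n * (1 + (√(1 - J ^ 2))⁻¹ + s * (J ^ 2)⁻¹) ^ 2)

/-- The gadget with parameter `J` and control precision `δ` reproduces, with error `ε n s`
(`s = d / 2`) in units of the reduction factor `α`, every target Hamiltonian on a `d`-regular
graph with `n` vertices whose coefficients lie in `[-1, 1]`, whatever the control errors bounded
by `δ`. Here `Δ_V = 0.95` is the adjusted gap `Δ - v (1 + Δ)` or less, for `Δ = 1` and a `v` with
`± V ≤ v (1 + H₀)`, where `H₀` is shifted to have ground energy `0`; the projector `P'` belongs to
the low-energy part of the spectrum of `H₀ + V`, which is separated from the rest; and the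
effective Hamiltonian is the low-energy block, in the logical basis, of the rotated `H₀ + V`. -/
def GadgetReproduces (n d : ℕ) (J ε δ : ℝ) : Prop :=
  ∀ (G : SimpleGraph (Fin n)) [DecidableRel G.Adj], G.IsRegularOfDegree d →
  ∀ (Jt : Fin n → Fin n → ℝ) (h t : Fin n → ℝ),
    (∀ i j, |Jt i j| ≤ 1) → (∀ i, |h i| ≤ 1) → (∀ i, |t i| ≤ 1) →
  ∀ (δh δt δJ δΩ : Fin n → ℝ) (δf : Fin n → Fin n → ℝ),
    (∀ i, |δh i| ≤ δ) → (∀ i, |δt i| ≤ δ) → (∀ i, |δJ i| ≤ δ) → (∀ i, |δΩ i| ≤ δ) →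
    (∀ i j, |δf i j| ≤ δ) →
  let s : ℝ := (d : ℝ) / 2
  let α : ℝ := reductionFactor n s ε J
  let H₀ := bareHam n J
  let V := perturbation G (fun i => α * h i + δh i)
    (fun i => α * (√(1 - J ^ 2))⁻¹ * t i + δt i)
    (fun i j => α * Jt i j / (J * J) + δf i j) δJ δΩ
  let P := groundProj n J
  let P' := spectralProj (H₀ + V) (Set.Iio (-(n : ℝ) + adjGap / 2))
  let W := logicalBasis n J
  (∃ v : ℝ, (v • (1 + (H₀ + (n : ℝ) • 1)) - V).PosSemidef ∧
      (v • (1 + (H₀ + (n : ℝ) • 1)) + V).PosSemidef ∧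
      adjGap ≤ 1 - v * (1 + 1) ∧
      spectrum ℝ (H₀ + V) ⊆
        Set.Icc (-(n : ℝ) - v) (-(n : ℝ) + v) ∪ Set.Ici (-(n : ℝ) + adjGap)) ∧
  ∃ U, IsSchriefferWolff P P' U ∧
    U * P' * Uᴴ = P ∧
    Commute P (U * (H₀ + V) * Uᴴ) ∧
    ‖Wᴴ * (U * (H₀ + V + (n : ℝ) • 1) * Uᴴ) * W - α • targetHam G Jt h t‖ ≤ α * (ε * n * s)

end QubitCoupler

end

/-!
The bare Hamiltonian is a sum of commuting one-site operators, so tensor products of the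
eigenvectors of one qubit with its coupler diagonalise it explicitly (`tensorOp`,
`bareHam_mul_tensorOp_siteBasis`). This gives its gap `2`, its ground projector and the logical
basis, and shows that a one-site operator `A` is compressed to the ground space as the one-site
operator `wᴴ A w`, with `w` the isometry `|b⟩ ↦ |b⟩|g_b⟩`. Hence `X` becomes `F X` and `Z_qc`
becomes `-J Z`, and the compression of the perturbation `V` is the reduced target Hamiltonian
`α H_target` plus control errors (`norm_conj_perturbation_sub_le`).

The remaining error is of second order in `v ≥ ‖V‖`. With `K` the bare Hamiltonian shifted to ground
energy `0`, the relations `P K = 0` and `K P' = (K + V) P' - V P'` and the gaps of `K` and `K + V`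
bound both off-diagonal blocks of `P - P'` by multiples of `v`. The Schrieffer–Wolff rotation is
`U = T (Tᴴ T)^(-1/2)` with `T = P P' + (1 - P) (1 - P')`; it satisfies `‖U - 1‖ ≤ √2 ‖P - P'‖`, because
`(U - 1)ᴴ (U - 1) = 2 (1 - (1 - (P - P')²)^(1/2))` (`exists_isSchriefferWolff`). As `P` annihilates
`K`, every correction to `P V P` in `P U (K + V) Uᴴ P` contains a factor `U - 1` or `Uᴴ - 1` and
another one of order `v`, which gives the error `10 v²` of `exists_schriefferWolff_block`.

The reduction factor `α` is of order `1 / n`, so that `v` is bounded uniformly in `n` although `V` has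
extensively many terms. The control errors take a quarter of the admissible error `α ε n s`, and
`10 v²` fits into the rest (`norm_budget`, `small_budget`, `error_budget`).

As a function of `J`, the bound on the control errors is a constant of order `ε² / n` times a function
that extends continuously to `[0, 1]` and vanishes at both ends, so its maximum is attained inside.
-/

namespace QubitCoupler

/-! ### Products of one-site operators -/

/-- The tensor product `⨂ᵢ Aᵢ` of (possibly rectangular) one-site matrices, in the product basis. -/
def tensorOp {n : ℕ} {κ κ' : Type} (A : Fin n → Matrix κ κ' ℂ) :
    Matrix (Fin n → κ) (Fin n → κ') ℂ :=
  Matrix.of fun x y => ∏ i, A i (x i) (y i)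

section tensorOp

variable {n : ℕ} {κ κ' κ'' : Type}

lemma tensorOp_apply (A : Fin n → Matrix κ κ' ℂ) (x : Fin n → κ) (y : Fin n → κ') :
    tensorOp A x y = ∏ i, A i (x i) (y i) := rfl

lemma tensorOp_mul [Fintype κ'] (A : Fin n → Matrix κ κ' ℂ) (B : Fin n → Matrix κ' κ'' ℂ) :
    tensorOp A * tensorOp B = tensorOp (fun i => A i * B i) := by
  ext x y
  simp only [Matrix.mul_apply, tensorOp_apply, ← Finset.prod_mul_distrib]
  rw [Finset.prod_univ_sum, Fintype.piFinset_univ]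

lemma tensorOp_conjTranspose (A : Fin n → Matrix κ κ' ℂ) :
    (tensorOp A)ᴴ = tensorOp (fun i => (A i)ᴴ) := by
  ext x y
  simp [Matrix.conjTranspose_apply, tensorOp_apply]

lemma tensorOp_diagonal [DecidableEq κ] (e : Fin n → κ → ℂ) :
    tensorOp (fun i => Matrix.diagonal (e i)) = Matrix.diagonal (fun x => ∏ i, e i (x i)) := by
  ext x y
  simp only [tensorOp_apply, Matrix.diagonal_apply, Finset.prod_ite_zero, Finset.mem_univ,
    true_imp_iff, funext_iff (f := x)]

lemma tensorOp_one [DecidableEq κ] :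
    tensorOp (fun _ : Fin n => (1 : Matrix κ κ ℂ)) = 1 := by
  simp only [← Matrix.diagonal_one, tensorOp_diagonal, Finset.prod_const_one]

lemma siteOp_eq_tensorOp [DecidableEq κ] (i : Fin n) (A : Matrix κ κ ℂ) :
    siteOp i A = tensorOp (Function.update (fun _ => 1) i A) := by
  ext x y
  rw [tensorOp_apply, ← Finset.mul_prod_erase _ _ (Finset.mem_univ i)]
  have h : ∀ j ∈ Finset.univ.erase i,
      Function.update (fun _ => (1 : Matrix κ κ ℂ)) i A j (x j) (y j) =
        if x j = y j then 1 else 0 := by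
    intro j hj
    rw [Function.update_of_ne (Finset.ne_of_mem_erase hj), Matrix.one_apply]
  rw [Finset.prod_congr rfl h, Finset.prod_ite_zero]
  simp [siteOp]

lemma siteOp_mul_tensorOp [Fintype κ] [DecidableEq κ] (i : Fin n) (A : Matrix κ κ ℂ)
    (B : Fin n → Matrix κ κ' ℂ) :
    siteOp i A * tensorOp B = tensorOp (Function.update B i (A * B i)) := by
  rw [siteOp_eq_tensorOp, tensorOp_mul]
  congr 1
  funext j
  by_cases h : j = i
  · subst h; simp
  · simp [Function.update_of_ne h]

lemma tensorOp_mul_siteOp [Fintype κ'] [DecidableEq κ'] (i : Fin n) (A : Matrix κ' κ' ℂ)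
    (B : Fin n → Matrix κ κ' ℂ) :
    tensorOp B * siteOp i A = tensorOp (Function.update B i (B i * A)) := by
  rw [siteOp_eq_tensorOp, tensorOp_mul]
  congr 1
  funext j
  by_cases h : j = i
  · subst h; simp
  · simp [Function.update_of_ne h]

lemma siteOp_mul_siteOp [Fintype κ] [DecidableEq κ] (i : Fin n) (A B : Matrix κ κ ℂ) :
    siteOp i A * siteOp i B = siteOp i (A * B) := by
  rw [siteOp_eq_tensorOp i B, siteOp_mul_tensorOp, siteOp_eq_tensorOp]
  simp

lemma siteOp_conjTranspose [DecidableEq κ] (i : Fin n) (A : Matrix κ κ ℂ) :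
    (siteOp i A)ᴴ = siteOp i Aᴴ := by
  ext x y
  simp only [Matrix.conjTranspose_apply, siteOp, Matrix.of_apply]
  simp only [eq_comm (a := y _)]
  split_ifs <;> simp

lemma siteOp_one [DecidableEq κ] (i : Fin n) : siteOp i (1 : Matrix κ κ ℂ) = 1 := by
  rw [siteOp_eq_tensorOp, Function.update_eq_self i (fun _ => (1 : Matrix κ κ ℂ)), tensorOp_one]

lemma siteOp_smul [DecidableEq κ] (i : Fin n) (c : ℝ) (A : Matrix κ κ ℂ) :
    siteOp i (c • A) = c • siteOp i A := by
  ext x y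
  simp [siteOp]

lemma siteOp_diagonal [DecidableEq κ] (i : Fin n) (e : κ → ℂ) :
    siteOp i (Matrix.diagonal e) = Matrix.diagonal (fun x => e (x i)) := by
  ext x y
  simp only [siteOp, Matrix.of_apply, Matrix.diagonal_apply, funext_iff]
  by_cases h : ∀ j, x j = y j
  · simp [h]
  · rw [if_neg h]
    split_ifs with h1 h2
    · exact absurd (fun j => if hj : j = i then hj ▸ h2 else h1 j hj) h
    · rfl
    · rfl

/-- Compression of a one-site operator by a product isometry acts on that site only. -/
lemma conj_siteOp [Fintype κ] [DecidableEq κ] [DecidableEq κ'] (w : Matrix κ κ' ℂ)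
    (hw : wᴴ * w = 1) (i : Fin n) (A : Matrix κ κ ℂ) :
    (tensorOp fun _ : Fin n => w)ᴴ * siteOp i A * tensorOp (fun _ : Fin n => w) =
      siteOp i (wᴴ * A * w) := by
  rw [Matrix.mul_assoc, siteOp_mul_tensorOp, tensorOp_conjTranspose, tensorOp_mul,
    siteOp_eq_tensorOp]
  congr 1
  funext j
  by_cases h : j = i
  · subst h; simp [Matrix.mul_assoc]
  · simp [Function.update_of_ne h, hw]

lemma conj_siteOp_mul_siteOp [Fintype κ] [DecidableEq κ] [Fintype κ'] [DecidableEq κ']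
    (w : Matrix κ κ' ℂ) (hw : wᴴ * w = 1) {i j : Fin n} (hij : i ≠ j) (A B : Matrix κ κ ℂ) :
    (tensorOp fun _ : Fin n => w)ᴴ * (siteOp i A * siteOp j B) * tensorOp (fun _ : Fin n => w) =
      siteOp i (wᴴ * A * w) * siteOp j (wᴴ * B * w) := by
  rw [Matrix.mul_assoc, Matrix.mul_assoc, siteOp_mul_tensorOp, siteOp_mul_tensorOp,
    tensorOp_conjTranspose, tensorOp_mul, siteOp_eq_tensorOp j, siteOp_mul_tensorOp]
  congr 1
  funext k
  by_cases h : k = i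
  · subst h; simp [Matrix.mul_assoc, Function.update_of_ne hij]
  · by_cases h' : k = j
    · subst h'; simp [Function.update_of_ne h, Matrix.mul_assoc]
    · simp [Function.update_of_ne h, Function.update_of_ne h', hw]

end tensorOp

/-! ### Functions and spectra of Hermitian matrices -/

section cfc

variable {ι : Type} [Fintype ι] [DecidableEq ι]

lemma continuousOn_spectrum (A : Matrix ι ι ℂ) (f : ℝ → ℝ) : ContinuousOn f (spectrum ℝ A) :=
  A.finite_real_spectrum.continuousOn f

lemma aeval_mul_of_mul_eq {A T B : Matrix ι ι ℂ} (h : A * T = T * B) (p : Polynomial ℝ) :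
    Polynomial.aeval A p * T = T * Polynomial.aeval B p := by
  induction p using Polynomial.induction_on' with
  | add p q hp hq => simp only [map_add, add_mul, mul_add, hp, hq]
  | monomial k c =>
    have hk : A ^ k * T = T * B ^ k := by
      induction k with
      | zero => simp
      | succ k ih => rw [pow_succ, mul_assoc, h, ← mul_assoc, ih, mul_assoc, ← pow_succ]
    simp only [Polynomial.aeval_monomial, mul_assoc, hk, Algebra.left_comm]

lemma aeval_diagonal (e : ι → ℝ) (p : Polynomial ℝ) :
    Polynomial.aeval (Matrix.diagonal (fun i => (e i : ℂ))) p =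
      Matrix.diagonal (fun i => ((p.eval (e i) : ℝ) : ℂ)) := by
  have h1 : Matrix.diagonal (fun i => (e i : ℂ)) =
      Matrix.diagonalAlgHom ℝ (fun i => (e i : ℂ)) := rfl
  rw [h1, Polynomial.aeval_algHom_apply]
  change Matrix.diagonal _ = _
  congr 1
  funext i
  rw [Polynomial.aeval_pi_apply]
  exact Polynomial.aeval_algebraMap_apply_eq_algebraMap_eval (A := ℂ) (e i) p

/-- The functional calculus of an explicitly diagonalised matrix: a function on the finitely many
relevant points is a polynomial, and polynomials respect intertwining relations. -/
lemma cfc_eq_of_mul_eq_mul_diagonal {A T : Matrix ι ι ℂ} (hA : A.IsHermitian) (hT : T * Tᴴ = 1)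
    (e : ι → ℝ) (h : A * T = T * Matrix.diagonal (fun i => (e i : ℂ))) (f : ℝ → ℝ) :
    cfc f A = T * Matrix.diagonal (fun i => (f (e i) : ℂ)) * Tᴴ := by
  classical
  set S : Finset ℝ := A.finite_real_spectrum.toFinset ∪ Finset.univ.image e
  set p : Polynomial ℝ := Lagrange.interpolate S id f
  have hp : ∀ x ∈ S, p.eval x = f x := fun x hx =>
    Lagrange.eval_interpolate_at_node (v := id) f (Set.injOn_id _) hx
  have h1 : cfc f A = Polynomial.aeval A p := by
    rw [← cfc_polynomial p A hA.isSelfAdjoint]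
    refine cfc_congr fun x hx => (hp x ?_).symm
    simp [S, hx]
  have h2 : cfc f A * T = T * Matrix.diagonal (fun i => (f (e i) : ℂ)) := by
    rw [h1, aeval_mul_of_mul_eq h, aeval_diagonal]
    congr 2
    funext i
    rw [hp _ (by simp [S])]
  rw [← h2, mul_assoc, hT, mul_one]

lemma spectrum_subset_range_of_mul_eq_mul_diagonal {A T : Matrix ι ι ℂ} (hT : T * Tᴴ = 1)
    (e : ι → ℝ) (h : A * T = T * Matrix.diagonal (fun i => (e i : ℂ))) :
    spectrum ℝ A ⊆ Set.range e := by
  intro x hx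
  by_contra hne
  refine hx (spectrum.mem_resolventSet_iff.mpr ?_)
  have hT' : Tᴴ * T = 1 := mul_eq_one_comm.mp hT
  have h1 : algebraMap ℝ (Matrix ι ι ℂ) x - A =
      T * Matrix.diagonal (fun i => ((x - e i : ℝ) : ℂ)) * Tᴴ := by
    have h2 : Matrix.diagonal (fun i => ((x - e i : ℝ) : ℂ)) =
        algebraMap ℝ (Matrix ι ι ℂ) x - Matrix.diagonal (fun i => (e i : ℂ)) := by
      rw [Matrix.algebraMap_eq_diagonal, Matrix.diagonal_sub]
      congr 1
      funext i
      simp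
    rw [h2, mul_sub, sub_mul, ← h, mul_assoc A, hT, mul_one, ← Algebra.commutes, mul_assoc, hT,
      mul_one]
  rw [h1]
  refine IsUnit.mul (IsUnit.mul ?_ ?_) ?_
  · exact IsUnit.of_mul_eq_one _ hT
  · refine IsUnit.of_mul_eq_one (Matrix.diagonal (fun i => ((x - e i : ℝ) : ℂ)⁻¹)) ?_
    rw [Matrix.diagonal_mul_diagonal, ← Matrix.diagonal_one]
    congr 1
    funext i
    refine mul_inv_cancel₀ ?_
    rw [Ne, Complex.ofReal_eq_zero, sub_eq_zero]
    exact fun h => hne ⟨i, h.symm⟩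
  · exact IsUnit.of_mul_eq_one _ hT'

/-- A perturbation of norm less than `m` moves no spectrum to a point at distance at least `m`
from the spectrum (Neumann series). -/
lemma notMem_spectrum_add {A V : Matrix ι ι ℂ} (hA : A.IsHermitian) {x m : ℝ} (hm : ‖V‖ < m)
    (h : ∀ y ∈ spectrum ℝ A, m ≤ |x - y|) : x ∉ spectrum ℝ (A + V) := by
  have hm0 : 0 < m := (norm_nonneg V).trans_lt hm
  have hne : ∀ y ∈ spectrum ℝ A, x - y ≠ 0 := fun y hy h0 => by
    have := h y hy
    rw [h0, abs_zero] at this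
    linarith
  have hA' : IsSelfAdjoint A := hA.isSelfAdjoint
  set R : Matrix ι ι ℂ := cfc (fun y => (x - y)⁻¹) A with hR
  have hsub : cfc (fun y => x - y) A = algebraMap ℝ _ x - A := by
    rw [cfc_sub (fun _ => x) (fun y => y) A, cfc_const x A, cfc_id' ℝ A]
  have hRA : (algebraMap ℝ _ x - A) * R = 1 := by
    rw [← hsub, hR, ← cfc_mul _ _ A (continuousOn_spectrum _ _) (continuousOn_spectrum _ _),
      ← cfc_const_one ℝ A]
    exact cfc_congr fun y hy => mul_inv_cancel₀ (hne y hy)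
  have hRn : ‖R‖ ≤ m⁻¹ := by
    refine norm_cfc_le (by positivity) fun y hy => ?_
    rw [Real.norm_eq_abs, abs_inv]
    exact inv_anti₀ hm0 (h y hy)
  have hVR : ‖V * R‖ < 1 := by
    refine (norm_mul_le _ _).trans_lt ?_
    calc ‖V‖ * ‖R‖ ≤ ‖V‖ * m⁻¹ := by gcongr
      _ < m * m⁻¹ := by gcongr
      _ = 1 := mul_inv_cancel₀ hm0.ne'
  have hu := isUnit_one_sub_of_norm_lt_one hVR
  have h3 : algebraMap ℝ (Matrix ι ι ℂ) x - (A + V) = (1 - V * R) * (algebraMap ℝ _ x - A) := by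
    have hRA' := mul_eq_one_comm.mp hRA
    rw [sub_mul, mul_assoc, hRA']
    simp [sub_sub]
  rw [spectrum.notMem_iff, h3]
  exact hu.mul (IsUnit.of_mul_eq_one _ hRA)

end cfc

/-! ### The Schrieffer–Wolff rotation of two nearby projections -/

section SchriefferWolff

variable {ι : Type} [Fintype ι] [DecidableEq ι]

lemma norm_star_projection_le {P : Matrix ι ι ℂ} (hP : IsStarProjection P) : ‖P‖ ≤ 1 := by
  have h : ‖P‖ * ‖P‖ = ‖P‖ := by
    rw [← CStarRing.norm_star_mul_self, hP.isSelfAdjoint.star_eq, hP.isIdempotentElem.eq]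
  nlinarith [norm_nonneg P]

lemma norm_le_one_of_conjTranspose_mul_self {κ κ' : Type} [Fintype κ] [Fintype κ']
    [DecidableEq κ'] {M : Matrix κ κ' ℂ} (h : Mᴴ * M = 1) : ‖M‖ ≤ 1 := by
  have h1 : ‖M‖ * ‖M‖ ≤ 1 := by
    rw [← Matrix.l2_opNorm_conjTranspose_mul_self, h]
    exact norm_star_projection_le (IsStarProjection.one _)
  nlinarith [norm_nonneg M]

/-- If `‖P - P'‖ < 1`, the rotation is `U = (P P' + (1 - P) (1 - P')) D^(-1/2)` with
`D = 1 - (P - P')²`, which commutes with both projections. The distance of `U` from `1` follows from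
`(U - 1)ᴴ (U - 1) = 2 (1 - D^(1/2))`. -/
theorem exists_isSchriefferWolff {P P' : Matrix ι ι ℂ} (hP : IsStarProjection P)
    (hP' : IsStarProjection P') (hlt : ‖P - P'‖ < 1) :
    ∃ U, IsSchriefferWolff P P' U ∧ U * P' = P * U ∧ ‖U - 1‖ ^ 2 ≤ 2 * ‖P - P'‖ ^ 2 := by
  have hPP : P * P = P := hP.isIdempotentElem.eq
  have hPP' : P' * P' = P' := hP'.isIdempotentElem.eq
  have hPx : ∀ x, P * (P * x) = P * x := fun x => by rw [← mul_assoc, hPP]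
  have hPx' : ∀ x, P' * (P' * x) = P' * x := fun x => by rw [← mul_assoc, hPP']
  have hPs : star P = P := hP.isSelfAdjoint.star_eq
  have hPs' : star P' = P' := hP'.isSelfAdjoint.star_eq
  set g := ‖P - P'‖ with hg
  have hg0 : 0 ≤ g := norm_nonneg _
  set D : Matrix ι ι ℂ := 1 - (P - P') * (P - P') with hD
  set T : Matrix ι ι ℂ := P * P' + (1 - P) * (1 - P') with hT
  have hDs : IsSelfAdjoint D := by
    rw [IsSelfAdjoint, hD]
    simp only [star_sub, star_mul, star_one, hPs, hPs']
  have hTs : star T = P' * P + (1 - P') * (1 - P) := by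
    simp only [hT, star_add, star_sub, star_mul, star_one, hPs, hPs']
  have hTT : star T * T = D := by
    rw [hTs, hT, hD]
    simp only [mul_sub, sub_mul, mul_add, add_mul, mul_one, one_mul, mul_assoc, hPP, hPP', hPx]
    abel
  have hTR : T * T = (2 * P - 1) * (2 * P' - 1) * D := by
    rw [hT, hD]
    simp only [two_mul, mul_sub, sub_mul, mul_add, add_mul, mul_one, one_mul, mul_assoc, hPP, hPP',
      hPx, hPx']
    abel
  have hTD : T + star T = 2 * D := by
    rw [hTs, hT, hD, two_mul]
    simp only [mul_sub, sub_mul, mul_one, one_mul, hPP, hPP']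
    abel
  have hTP : T * P' = P * T := by
    rw [hT]
    simp only [mul_sub, sub_mul, mul_add, add_mul, mul_one, one_mul, mul_assoc, hPP, hPP', hPx]
    abel
  have hDP : Commute D P := by
    rw [commute_iff_eq, hD]
    simp only [mul_sub, sub_mul, mul_one, one_mul, mul_assoc, hPP, hPP', hPx]
    abel
  have hDP' : Commute D P' := by
    rw [commute_iff_eq, hD]
    simp only [mul_sub, sub_mul, mul_one, one_mul, mul_assoc, hPP, hPP', hPx']
    abel
  have hDT : Commute D T := by
    refine (hDP.mul_right hDP').add_right (Commute.mul_right ?_ ?_)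
    · exact (Commute.one_right _).sub_right hDP
    · exact (Commute.one_right _).sub_right hDP'
  have hDT' : Commute D (star T) := by
    rw [hTs]
    refine (hDP'.mul_right hDP).add_right (Commute.mul_right ?_ ?_)
    · exact (Commute.one_right _).sub_right hDP'
    · exact (Commute.one_right _).sub_right hDP
  -- the spectrum of `D` lies in `[1 - g², 1 + g²]`
  have hspec : ∀ x ∈ spectrum ℝ D, |1 - x| ≤ g ^ 2 := by
    intro x hx
    by_contra! hlt'
    refine notMem_spectrum_add (A := 1) (V := -((P - P') * (P - P'))) (x := x) (m := |1 - x|)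
      Matrix.isHermitian_one ?_ ?_ ?_
    · rw [norm_neg]
      refine (norm_mul_le _ _).trans_lt ?_
      rwa [← hg, ← sq]
    · intro y hy
      have hy' : y = 1 := by
        by_contra hne
        refine hy (spectrum.mem_resolventSet_iff.mpr ?_)
        rw [← map_one (algebraMap ℝ (Matrix ι ι ℂ)), ← map_sub]
        exact (IsUnit.mk0 _ (sub_ne_zero.mpr hne)).map _
      rw [hy', abs_sub_comm]
    · rwa [← sub_eq_add_neg]
  have hpos : ∀ x ∈ spectrum ℝ D, 0 < x := by
    intro x hx
    have h1 := (abs_le.mp (hspec x hx)).2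
    nlinarith
  set S : Matrix ι ι ℂ := cfc Real.sqrt D with hS
  set Si : Matrix ι ι ℂ := cfc (fun x => (√x)⁻¹) D with hSi
  have hSs : IsSelfAdjoint S := cfc_predicate _ _
  have hSis : star Si = Si := (cfc_predicate (R := ℝ) (p := IsSelfAdjoint) _ D : IsSelfAdjoint Si)
  have hSS : S * S = D := by
    conv_rhs => rw [← cfc_id' ℝ D]
    rw [hS, ← cfc_mul _ _ D (continuousOn_spectrum _ _) (continuousOn_spectrum _ _)]
    exact cfc_congr fun x hx => Real.mul_self_sqrt (hpos x hx).le
  have hSSi : S * Si = 1 := by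
    rw [hS, hSi, ← cfc_mul _ _ D (continuousOn_spectrum _ _) (continuousOn_spectrum _ _),
      ← cfc_const_one ℝ D]
    exact cfc_congr fun x hx => mul_inv_cancel₀ (Real.sqrt_ne_zero'.mpr (hpos x hx))
  have hSiS : Si * S = 1 := mul_eq_one_comm.mp hSSi
  have hDSi : D * Si = S := by rw [← hSS, mul_assoc, hSSi, mul_one]
  have hSiT : Commute Si T := hDT.cfc_real _
  have hSiT' : Commute Si (star T) := hDT'.cfc_real _
  have hSiP' : Commute Si P' := hDP'.cfc_real _
  have hUU : star (T * Si) * (T * Si) = 1 := by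
    rw [star_mul, hSis, mul_assoc, ← mul_assoc (star T), hTT, hDSi, hSiS]
  have hUadd : T * Si + star (T * Si) = 2 * S := by
    rw [star_mul, hSis, hSiT'.eq, ← add_mul, hTD, mul_assoc, hDSi]
  refine ⟨T * Si, ⟨?_, ?_, ?_⟩, ?_, ?_⟩
  · rw [Matrix.mem_unitaryGroup_iff']
    exact hUU
  · rw [mul_assoc, ← mul_assoc Si, hSiT.eq, mul_assoc T, ← mul_assoc T T, hTR, mul_assoc,
      ← mul_assoc D, hDSi, hSSi, mul_one]
  · change (T * Si + star (T * Si)).PosDef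
    rw [hUadd]
    -- `S` is the square of an invertible Hermitian matrix
    set Q : Matrix ι ι ℂ := cfc (fun x => √(√x)) D with hQ
    have hQQ : Q * Q = S := by
      rw [hQ, hS, ← cfc_mul _ _ D (continuousOn_spectrum _ _) (continuousOn_spectrum _ _)]
      exact cfc_congr fun x hx => Real.mul_self_sqrt (Real.sqrt_nonneg x)
    have hQs : Qᴴ = Q := (cfc_predicate (R := ℝ) (p := IsSelfAdjoint) _ D : IsSelfAdjoint Q)
    have hQi : Q * (Q * Si) = 1 := by rw [← mul_assoc, hQQ, hSSi]
    have hpd : (Qᴴ * Q).PosDef := by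
      refine Matrix.PosDef.conjTranspose_mul_self Q ?_
      exact Matrix.mulVec_injective_of_isUnit (IsUnit.of_mul_eq_one _ hQi)
    rw [hQs, hQQ] at hpd
    rw [two_mul]
    exact hpd.add hpd
  · rw [mul_assoc, hSiP'.eq, ← mul_assoc, hTP, mul_assoc]
  · have h1 : star (T * Si - 1) * (T * Si - 1) = 2 * (1 - S) := by
      calc star (T * Si - 1) * (T * Si - 1)
          = star (T * Si) * (T * Si) + 1 - (T * Si + star (T * Si)) := by
            simp only [star_sub, star_one]; noncomm_ring
        _ = 2 * (1 - S) := by rw [hUU, hUadd]; noncomm_ring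
    have h2 : ‖(1 : Matrix ι ι ℂ) - S‖ ≤ g ^ 2 := by
      have h3 : (1 : Matrix ι ι ℂ) - S = cfc (fun x => 1 - √x) D := by
        rw [cfc_sub _ _ D (continuousOn_spectrum _ _) (continuousOn_spectrum _ _),
          cfc_const_one ℝ D]
      rw [h3]
      refine norm_cfc_le (by positivity) fun x hx => le_trans ?_ (hspec x hx)
      have h4 : 1 - x = (1 - √x) * (1 + √x) := by
        have := Real.mul_self_sqrt (hpos x hx).le
        linarith
      rw [h4, abs_mul, Real.norm_eq_abs]
      refine le_mul_of_one_le_right (abs_nonneg _) ?_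
      rw [abs_of_nonneg (by positivity)]
      linarith [Real.sqrt_nonneg x]
    rw [sq, ← CStarRing.norm_star_mul_self, h1, two_mul]
    refine (norm_add_le _ _).trans ?_
    linarith

end SchriefferWolff

/-! ### Second-order perturbation theory for an isolated ground space -/

section perturbation

variable {ι : Type} [Fintype ι] [DecidableEq ι]

lemma isStarProjection_spectralProj (A : Matrix ι ι ℂ) (S : Set ℝ) :
    IsStarProjection (spectralProj A S) := by
  refine ⟨?_, cfc_predicate _ _⟩
  rw [IsIdempotentElem, spectralProj,
    ← cfc_mul _ _ A (continuousOn_spectrum _ _) (continuousOn_spectrum _ _)]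
  refine cfc_congr fun x _ => ?_
  by_cases h : x ∈ S <;> simp [h]

lemma cfc_sub_const {A : Matrix ι ι ℂ} (hA : A.IsHermitian) (E : ℝ) :
    cfc (fun x => x - E) A = A - E • 1 := by
  have hA' : IsSelfAdjoint A := hA.isSelfAdjoint
  rw [cfc_sub _ _ A (continuousOn_spectrum _ _) (continuousOn_spectrum _ _), cfc_const E A,
    cfc_id' ℝ A, Algebra.algebraMap_eq_smul_one]

lemma norm_sub_mul_spectralProj_le {A : Matrix ι ι ℂ} (hA : A.IsHermitian) {E v : ℝ} (hv : 0 ≤ v)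
    {S : Set ℝ} (h : ∀ x ∈ spectrum ℝ A, x ∈ S → |x - E| ≤ v) :
    ‖(A - E • 1) * spectralProj A S‖ ≤ v := by
  rw [← cfc_sub_const hA, spectralProj,
    ← cfc_mul _ _ A (continuousOn_spectrum _ _) (continuousOn_spectrum _ _)]
  refine norm_cfc_le hv fun x hx => ?_
  by_cases hxS : x ∈ S
  · simpa [hxS] using h x hx hxS
  · simpa [hxS] using hv

/-- Off the spectral subspace of `S`, the matrix `A - E` has an inverse whose norm is controlled by
the distance of `E` from the rest of the spectrum. -/
lemma exists_partial_inverse {A : Matrix ι ι ℂ} (hA : A.IsHermitian) {E m : ℝ} (hm : 0 < m)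
    {S : Set ℝ} (h : ∀ x ∈ spectrum ℝ A, x ∉ S → m ≤ |x - E|) :
    ∃ R : Matrix ι ι ℂ, ‖R‖ ≤ m⁻¹ ∧ R * (A - E • 1) = 1 - spectralProj A S ∧
      (A - E • 1) * R = 1 - spectralProj A S := by
  have hA' : IsSelfAdjoint A := hA.isSelfAdjoint
  classical
  have key : ∀ x ∈ spectrum ℝ A,
      (Sᶜ.indicator (fun x => (x - E)⁻¹) x) * (x - E) = 1 - S.indicator (fun _ => 1) x := by
    intro x hx
    by_cases hxS : x ∈ S
    · simp [hxS]
    · have : x - E ≠ 0 := fun h0 => by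
        have := h x hx hxS
        rw [h0, abs_zero] at this
        linarith
      simp [hxS, this]
  have hone : 1 - spectralProj A S = cfc (fun x => 1 - S.indicator (fun _ => (1 : ℝ)) x) A := by
    rw [cfc_sub _ _ A (continuousOn_spectrum _ _) (continuousOn_spectrum _ _),
      cfc_const_one ℝ A, spectralProj]
  refine ⟨cfc (Sᶜ.indicator fun x => (x - E)⁻¹) A, ?_, ?_, ?_⟩
  · refine norm_cfc_le (by positivity) fun x hx => ?_
    by_cases hxS : x ∈ S
    · simpa [hxS] using hm.le
    · simp only [Set.mem_compl_iff, hxS, not_false_eq_true, Set.indicator_of_mem,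
        Real.norm_eq_abs, abs_inv]
      exact inv_anti₀ hm (h x hx hxS)
  · rw [hone, ← cfc_sub_const hA,
      ← cfc_mul _ _ A (continuousOn_spectrum _ _) (continuousOn_spectrum _ _)]
    exact cfc_congr key
  · rw [hone, ← cfc_sub_const hA,
      ← cfc_mul _ _ A (continuousOn_spectrum _ _) (continuousOn_spectrum _ _)]
    exact cfc_congr fun x hx => (mul_comm _ _).trans (key x hx)

/-- Weyl's inequality for a ground energy `E` with gap `g`. -/
lemma spectrum_add_subset {A V : Matrix ι ι ℂ} (hA : A.IsHermitian) {E g v : ℝ}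
    (hspec : spectrum ℝ A ⊆ {E} ∪ Set.Ici (E + g)) (hg : 0 ≤ g) (hv : ‖V‖ ≤ v) :
    spectrum ℝ (A + V) ⊆ Set.Icc (E - v) (E + v) ∪ Set.Ici (E + g - v) := by
  intro x hx
  by_contra hne
  simp only [Set.mem_union, Set.mem_Icc, Set.mem_Ici, not_or, not_and, not_le] at hne
  obtain ⟨h1, h2⟩ := hne
  have hfar : ∃ m, v < m ∧ ∀ y ∈ spectrum ℝ A, m ≤ |x - y| := by
    rcases lt_or_ge x (E - v) with h3 | h3
    · refine ⟨E - x, by linarith, fun y hy => ?_⟩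
      rw [abs_sub_comm]
      refine le_trans ?_ (le_abs_self _)
      rcases hspec hy with hy | hy
      · rw [Set.mem_singleton_iff.mp hy]
      · have := Set.mem_Ici.mp hy
        linarith
    · have h4 := h1 h3
      refine ⟨min (x - E) (E + g - x), lt_min (by linarith) (by linarith), fun y hy => ?_⟩
      rcases hspec hy with hy | hy
      · rw [Set.mem_singleton_iff.mp hy]
        exact (min_le_left _ _).trans (le_abs_self _)
      · have := Set.mem_Ici.mp hy
        rw [abs_sub_comm]
        exact (min_le_right _ _).trans (le_trans (by linarith) (le_abs_self _))
  obtain ⟨m, hm, hm'⟩ := hfar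
  exact notMem_spectrum_add hA (hv.trans_lt hm) hm' hx

/-- Let `A` have ground energy `E` and gap `2`, and let `‖V‖ ≤ v` be small. The Schrieffer–Wolff
rotation exists and block-diagonalises `A + V`, and on the ground space of `A` the rotated
operator `A + V - E` is `P V P` up to an error of second order in `v`. -/
theorem exists_schriefferWolff_block {A V : Matrix ι ι ℂ} (hA : A.IsHermitian)
    (hV : V.IsHermitian) {E v c : ℝ} (hspec : spectrum ℝ A ⊆ {E} ∪ Set.Ici (E + 2))
    (hv : ‖V‖ ≤ v) (hv' : v ≤ 1 / 40) (hc : v < c) (hc' : c ≤ 1) :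
    ∃ U, IsSchriefferWolff (spectralProj A {E}) (spectralProj (A + V) (Set.Iio (E + c))) U ∧
      U * spectralProj (A + V) (Set.Iio (E + c)) * Uᴴ = spectralProj A {E} ∧
      Commute (spectralProj A {E}) (U * (A + V) * Uᴴ) ∧
      ‖spectralProj A {E} * (U * (A + V - E • 1) * Uᴴ) * spectralProj A {E} -
        spectralProj A {E} * V * spectralProj A {E}‖ ≤ 10 * v ^ 2 := by
  have hv0 : 0 ≤ v := (norm_nonneg V).trans hv
  have hB : (A + V).IsHermitian := hA.add hV
  have hspecB := spectrum_add_subset hA hspec zero_le_two hv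
  set P := spectralProj A {E} with hPdef
  set P' := spectralProj (A + V) (Set.Iio (E + c)) with hPdef'
  have hP : IsStarProjection P := isStarProjection_spectralProj _ _
  have hP' : IsStarProjection P' := isStarProjection_spectralProj _ _
  have hPn : ‖P‖ ≤ 1 := norm_star_projection_le hP
  have hPn' : ‖P'‖ ≤ 1 := norm_star_projection_le hP'
  have hKP : (A - E • 1) * P = 0 := by
    rw [← norm_le_zero_iff]
    refine norm_sub_mul_spectralProj_le hA le_rfl fun x _ hx => ?_
    rw [Set.mem_singleton_iff.mp hx, sub_self, abs_zero]
  have hKs : star (A - E • (1 : Matrix ι ι ℂ)) = A - E • 1 := by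
    have : star A = A := hA
    simp [this]
  have hPK : P * (A - E • 1) = 0 := by
    have := congrArg star hKP
    rwa [star_mul, hKs, hP.isSelfAdjoint.star_eq, star_zero] at this
  have hBP' : ‖(A + V - E • 1) * P'‖ ≤ v := by
    refine norm_sub_mul_spectralProj_le hB hv0 fun x hx hx' => ?_
    have hx'' := Set.mem_Iio.mp hx'
    rcases hspecB hx with h | h
    · rw [abs_le]
      constructor <;> linarith [h.1, h.2]
    · linarith [Set.mem_Ici.mp h]
  obtain ⟨R, hRn, hR, -⟩ := exists_partial_inverse hA (E := E) (m := 2) two_pos (S := {E})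
    (fun x hx hx' => by
      rcases hspec hx with h | h
      · exact absurd h hx'
      · exact le_trans (by linarith [Set.mem_Ici.mp h]) (le_abs_self _))
  obtain ⟨R', hRn', -, hR'⟩ := exists_partial_inverse hB (E := E) (m := 2 - v) (by linarith)
    (S := Set.Iio (E + c)) (fun x hx hx' => by
      have hx'' := not_lt.mp (mt Set.mem_Iio.mpr hx')
      rcases hspecB hx with h | h
      · linarith [h.2]
      · exact le_trans (by linarith [Set.mem_Ici.mp h]) (le_abs_self _))
  rw [← hPdef] at hR
  rw [← hPdef'] at hR'
  have hKP' : ‖(A - E • 1) * P'‖ ≤ 2 * v := by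
    have h1 : (A - E • 1) * P' = (A + V - E • 1) * P' - V * P' := by noncomm_ring
    rw [h1]
    refine (norm_sub_le _ _).trans ?_
    have h2 : ‖V * P'‖ ≤ v * 1 := (norm_mul_le _ _).trans (by gcongr)
    linarith
  have h1 : ‖(1 - P) * P'‖ ≤ v := by
    rw [← hR, mul_assoc]
    calc ‖R * ((A - E • 1) * P')‖ ≤ ‖R‖ * ‖(A - E • 1) * P'‖ := norm_mul_le _ _
      _ ≤ 2⁻¹ * (2 * v) := by gcongr
      _ = v := by ring
  have h2 : ‖P * (1 - P')‖ ≤ v * (2 - v)⁻¹ := by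
    have h3 : P * (1 - P') = P * V * R' := by
      have h4 : P * (A + V - E • 1) = P * V := by
        have h5 : P * (A + V - E • 1) = P * (A - E • 1) + P * V := by noncomm_ring
        rw [h5, hPK, zero_add]
      rw [← hR', ← mul_assoc, h4]
    rw [h3]
    calc ‖P * V * R'‖ ≤ ‖P * V‖ * ‖R'‖ := norm_mul_le _ _
      _ ≤ (‖P‖ * ‖V‖) * ‖R'‖ := by gcongr; exact norm_mul_le _ _
      _ ≤ (1 * v) * (2 - v)⁻¹ := by gcongr
      _ = v * (2 - v)⁻¹ := by ring
  have hg : ‖P - P'‖ ≤ 1.51 * v := by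
    have h3 : P - P' = P * (1 - P') - (1 - P) * P' := by noncomm_ring
    rw [h3]
    refine (norm_sub_le _ _).trans ?_
    have h4 : (2 - v)⁻¹ ≤ 0.51 := by
      rw [inv_le_comm₀ (by linarith) (by norm_num)]
      norm_num
      linarith
    have h5 : v * (2 - v)⁻¹ ≤ v * 0.51 := by gcongr
    linarith
  obtain ⟨U, hU, hUP, hU1⟩ := exists_isSchriefferWolff hP hP' (by linarith)
  have hUU : U * Uᴴ = 1 := Matrix.mem_unitaryGroup_iff.mp hU.1
  have hUU' : Uᴴ * U = 1 := Matrix.mem_unitaryGroup_iff'.mp hU.1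
  have hPU : P' * Uᴴ = Uᴴ * P := by
    calc P' * Uᴴ = Uᴴ * (U * P') * Uᴴ := by rw [← mul_assoc, hUU', one_mul]
      _ = Uᴴ * P := by rw [hUP, mul_assoc, mul_assoc, hUU, mul_one]
  have hBc : Commute (A + V) P' := by
    have hB' : IsSelfAdjoint (A + V) := hB.isSelfAdjoint
    have := cfc_commute_cfc (fun x : ℝ => x) ((Set.Iio (E + c)).indicator fun _ => (1 : ℝ)) (A + V)
    rwa [cfc_id' ℝ (A + V)] at this
  have hu : ‖U - 1‖ ≤ 3 / 2 * (1.51 * v) := by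
    refine abs_le_of_sq_le_sq' ?_ (by positivity) |>.2
    have h3 : ‖P - P'‖ ^ 2 ≤ (1.51 * v) ^ 2 := by gcongr
    nlinarith [sq_nonneg v]
  have hu' : ‖Uᴴ - 1‖ ≤ 3 / 2 * (1.51 * v) := by
    rwa [← Matrix.l2_opNorm_conjTranspose, Matrix.conjTranspose_sub,
      Matrix.conjTranspose_conjTranspose, Matrix.conjTranspose_one]
  have hUn : ‖Uᴴ‖ ≤ 1 := by
    rw [Matrix.l2_opNorm_conjTranspose]
    exact norm_le_one_of_conjTranspose_mul_self hUU'
  refine ⟨U, hU, ?_, ?_, ?_⟩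
  · rw [hUP, mul_assoc, hUU, mul_one]
  · rw [commute_iff_eq]
    calc P * (U * (A + V) * Uᴴ) = P * U * (A + V) * Uᴴ := by simp only [mul_assoc]
      _ = U * (P' * (A + V)) * Uᴴ := by rw [← hUP]; simp only [mul_assoc]
      _ = U * (A + V) * (P' * Uᴴ) := by rw [← hBc.eq]; simp only [mul_assoc]
      _ = U * (A + V) * Uᴴ * P := by rw [hPU]; simp only [mul_assoc]
  · have hKU : ‖(A - E • 1) * (Uᴴ * P)‖ ≤ 2 * v := by
      rw [← hPU, ← mul_assoc]
      calc ‖(A - E • 1) * P' * Uᴴ‖ ≤ ‖(A - E • 1) * P'‖ * ‖Uᴴ‖ := norm_mul_le _ _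
        _ ≤ (2 * v) * 1 := by gcongr
        _ = 2 * v := mul_one _
    have hUPn : ‖Uᴴ * P‖ ≤ 1 := by
      calc ‖Uᴴ * P‖ ≤ ‖Uᴴ‖ * ‖P‖ := norm_mul_le _ _
        _ ≤ 1 * 1 := by gcongr
        _ = 1 := mul_one _
    -- `P` annihilates `A - E`, so both occurrences of `U` may be replaced by `U - 1`
    have hsplit : P * (U * (A + V - E • 1) * Uᴴ) * P - P * V * P =
        P * ((U - 1) * ((A - E • 1) * (Uᴴ * P))) + P * ((U - 1) * (V * (Uᴴ * P))) +
          P * (V * ((Uᴴ - 1) * P)) := by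
      have h3 : P * ((U - 1) * ((A - E • 1) * (Uᴴ * P))) =
          P * (U * ((A - E • 1) * (Uᴴ * P))) := by
        rw [sub_mul, mul_sub, one_mul, ← mul_assoc P (A - E • 1), hPK, zero_mul, sub_zero]
      rw [h3]
      noncomm_ring
    have b1 : ‖P * ((U - 1) * ((A - E • 1) * (Uᴴ * P)))‖ ≤
        1 * (3 / 2 * (1.51 * v) * (2 * v)) := by
      refine (norm_mul_le _ _).trans ?_
      gcongr
      refine (norm_mul_le _ _).trans ?_
      gcongr
    have b2 : ‖P * ((U - 1) * (V * (Uᴴ * P)))‖ ≤ 1 * (3 / 2 * (1.51 * v) * (v * 1)) := by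
      refine (norm_mul_le _ _).trans ?_
      gcongr
      refine (norm_mul_le _ _).trans ?_
      gcongr
      refine (norm_mul_le _ _).trans ?_
      gcongr
    have b3 : ‖P * (V * ((Uᴴ - 1) * P))‖ ≤ 1 * (v * (3 / 2 * (1.51 * v) * 1)) := by
      refine (norm_mul_le _ _).trans ?_
      gcongr
      refine (norm_mul_le _ _).trans ?_
      gcongr
      refine (norm_mul_le _ _).trans ?_
      gcongr
    rw [hsplit]
    refine (norm_add₃_le).trans ?_
    nlinarith [sq_nonneg v]

end perturbation

/-! ### A qubit and its coupler -/

/-- The amplitudes `p = √((1 - J)/2)` and `q = √((1 + J)/2)` of the ground vectors turn every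
identity about one coupler into a polynomial identity modulo `p² + q² = 1`. -/
lemma exists_amplitudes {J : ℝ} (hJ : J ∈ Set.Ioo (0 : ℝ) 1) :
    ∃ p q : ℝ, p ^ 2 + q ^ 2 = 1 ∧ J = q ^ 2 - p ^ 2 ∧ √(1 - J ^ 2) = 2 * p * q ∧
      couplerGround J 0 = ![(p : ℂ), -(q : ℂ)] ∧ couplerGround J 1 = ![(q : ℂ), -(p : ℂ)] := by
  obtain ⟨h0, h1⟩ := hJ
  have hp : √((1 - J) / 2) ^ 2 = (1 - J) / 2 := Real.sq_sqrt (by linarith)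
  have hq : √((1 + J) / 2) ^ 2 = (1 + J) / 2 := Real.sq_sqrt (by linarith)
  refine ⟨√((1 - J) / 2), √((1 + J) / 2), by linarith, by linarith, ?_, ?_, ?_⟩
  · rw [Real.sqrt_eq_iff_eq_sq (by nlinarith) (by positivity), mul_pow, mul_pow, hp, hq]
    ring
  · simp [couplerGround, zSign]
  · simp [couplerGround, zSign, sub_eq_add_neg]

/-- The energies of the eigenvectors of a qubit with its coupler; the second index is `0` for the
ground vector of the coupler and `1` for the excited one. -/
def siteEnergy (x : Fin 2 × Fin 2) : ℝ := if x.2 = 0 then -1 else 1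

/-- The excited vector of the coupler Hamiltonian `H_m ± I_m`. -/
noncomputable def couplerExcited (J : ℝ) (b : Fin 2) : Fin 2 → ℂ :=
  ![-couplerGround J b 1, couplerGround J b 0]

/-- The eigenvectors, as columns, of the coupler Hamiltonian `H_m ± I_m`. -/
noncomputable def couplerBasis (J : ℝ) (b : Fin 2) : Matrix (Fin 2) (Fin 2) ℂ :=
  Matrix.of fun c k => if k = 0 then couplerGround J b c else couplerExcited J b c

/-- The eigenvectors, as columns, of a qubit with its coupler. -/
noncomputable def siteBasis (J : ℝ) : Matrix (Fin 2 × Fin 2) (Fin 2 × Fin 2) ℂ :=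
  Matrix.of fun x y => if x.1 = y.1 then couplerBasis J y.1 x.2 y.2 else 0

/-- The isometry `|b⟩ ↦ |b⟩|g_b⟩` from a qubit to a qubit with its coupler. -/
noncomputable def siteIsometry (J : ℝ) : Matrix (Fin 2 × Fin 2) (Fin 2) ℂ :=
  Matrix.of fun x b => if x.1 = b then couplerGround J b x.2 else 0

/-- The bare Hamiltonian of one site. -/
noncomputable def siteHam (J : ℝ) : Matrix (Fin 2 × Fin 2) (Fin 2 × Fin 2) ℂ :=
  couplerOp (couplerHm J) + qubitOp pauliZ * couplerOp (couplerIm J)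

lemma pauliX_conjTranspose : pauliXᴴ = pauliX := by
  ext a b; fin_cases a <;> fin_cases b <;> simp [pauliX]

lemma pauliZ_conjTranspose : pauliZᴴ = pauliZ := by
  ext a b; fin_cases a <;> fin_cases b <;> simp [pauliZ]

lemma pauliX_mul_self : pauliX * pauliX = 1 := by
  ext a b; fin_cases a <;> fin_cases b <;> simp [pauliX]

lemma pauliZ_mul_self : pauliZ * pauliZ = 1 := by
  ext a b; fin_cases a <;> fin_cases b <;> simp [pauliZ]


lemma couplerBasis_mul_conjTranspose {J : ℝ} (hJ : J ∈ Set.Ioo (0 : ℝ) 1) (b : Fin 2) :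
    couplerBasis J b * (couplerBasis J b)ᴴ = 1 := by
  obtain ⟨p, q, h1, -, -, h0, h1'⟩ := exists_amplitudes hJ
  have h1 : (p : ℂ) ^ 2 + (q : ℂ) ^ 2 = 1 := by exact_mod_cast h1
  ext a c
  fin_cases b <;> fin_cases a <;> fin_cases c <;>
    simp [Matrix.mul_apply, couplerBasis, couplerExcited, h0, h1'] <;> grind

lemma coupler_mul_couplerBasis {J : ℝ} (hJ : J ∈ Set.Ioo (0 : ℝ) 1) (b : Fin 2) :
    (couplerHm J + zSign b • couplerIm J) * couplerBasis J b =
      couplerBasis J b * Matrix.diagonal (fun k => ((if k = 0 then -1 else 1 : ℝ) : ℂ)) := by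
  obtain ⟨p, q, h1, hJ, hF, h0, h1'⟩ := exists_amplitudes hJ
  have h1 : (p : ℂ) ^ 2 + (q : ℂ) ^ 2 = 1 := by exact_mod_cast h1
  have hF' : (√(1 - J ^ 2) : ℂ) = 2 * p * q := by exact_mod_cast congrArg Complex.ofReal hF
  have hJ' : (J : ℂ) = q ^ 2 - p ^ 2 := by exact_mod_cast congrArg Complex.ofReal hJ
  ext a c
  fin_cases b <;> fin_cases a <;> fin_cases c <;>
    simp [Matrix.mul_apply, couplerBasis, couplerExcited, h0, h1', couplerHm, couplerIm, pauliX,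
      pauliZ, zSign, hF', hJ'] <;> grind

lemma coupler_isHermitian (J : ℝ) (b : Fin 2) :
    (couplerHm J + zSign b • couplerIm J).IsHermitian := by
  have h1 : (couplerHm J).IsHermitian := by
    rw [Matrix.IsHermitian, couplerHm, Matrix.conjTranspose_smul, pauliX_conjTranspose, star_trivial]
  have h2 : (couplerIm J).IsHermitian := by
    rw [Matrix.IsHermitian, couplerIm, Matrix.conjTranspose_smul, pauliZ_conjTranspose, star_trivial]
  refine h1.add ?_
  rw [Matrix.IsHermitian, Matrix.conjTranspose_smul, h2, star_trivial]

lemma couplerState_eq {J : ℝ} (hJ : J ∈ Set.Ioo (0 : ℝ) 1) (b : Fin 2) :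
    couplerState J b = Matrix.vecMulVec (couplerGround J b) (star (couplerGround J b)) := by
  rw [couplerState, spectralProj, cfc_eq_of_mul_eq_mul_diagonal (coupler_isHermitian J b)
    (couplerBasis_mul_conjTranspose hJ b) _ (coupler_mul_couplerBasis hJ b)]
  ext a c
  simp [Matrix.mul_apply, couplerBasis, Matrix.vecMulVec_apply, Matrix.diagonal_apply,
    Set.indicator_apply]
  norm_num

lemma chi_eq {J : ℝ} (hJ : J ∈ Set.Ioo (0 : ℝ) 1) : chi J = (J : ℂ) := by
  rw [chi, couplerState_eq hJ]
  obtain ⟨p, q, -, hJ, -, -, h1'⟩ := exists_amplitudes hJ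
  have hJ' : (J : ℂ) = q ^ 2 - p ^ 2 := by exact_mod_cast congrArg Complex.ofReal hJ
  simp only [Matrix.trace, Matrix.diag_apply, Matrix.mul_apply, Matrix.vecMulVec_apply]
  simp [h1', pauliZ, hJ']
  ring

lemma overlap_eq {J : ℝ} (hJ : J ∈ Set.Ioo (0 : ℝ) 1) :
    overlap J = ((√(1 - J ^ 2) : ℝ) : ℂ) := by
  obtain ⟨p, q, -, -, hF, h0, h1'⟩ := exists_amplitudes hJ
  simp [overlap, h0, h1', hF, dotProduct]
  ring

/-! ### One site of the gadget -/

lemma qubitOp_conjTranspose (A : Matrix (Fin 2) (Fin 2) ℂ) : (qubitOp A)ᴴ = qubitOp Aᴴ := by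
  simp [qubitOp, Matrix.conjTranspose_kronecker]

lemma couplerOp_conjTranspose (A : Matrix (Fin 2) (Fin 2) ℂ) :
    (couplerOp A)ᴴ = couplerOp Aᴴ := by
  simp [couplerOp, Matrix.conjTranspose_kronecker]

lemma qubitOp_mul_qubitOp (A B : Matrix (Fin 2) (Fin 2) ℂ) :
    qubitOp A * qubitOp B = qubitOp (A * B) := by
  simp [qubitOp, ← Matrix.mul_kronecker_mul]

lemma couplerOp_mul_couplerOp (A B : Matrix (Fin 2) (Fin 2) ℂ) :
    couplerOp A * couplerOp B = couplerOp (A * B) := by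
  simp [couplerOp, ← Matrix.mul_kronecker_mul]

lemma qubitOp_mul_couplerOp (A B : Matrix (Fin 2) (Fin 2) ℂ) :
    qubitOp A * couplerOp B = A ⊗ₖ B := by
  simp [qubitOp, couplerOp, ← Matrix.mul_kronecker_mul]

lemma couplerOp_mul_qubitOp (A B : Matrix (Fin 2) (Fin 2) ℂ) :
    couplerOp B * qubitOp A = A ⊗ₖ B := by
  simp [qubitOp, couplerOp, ← Matrix.mul_kronecker_mul]

lemma qubitOp_one : qubitOp 1 = 1 := by simp [qubitOp]

lemma couplerOp_one : couplerOp 1 = 1 := by simp [couplerOp]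

lemma siteHam_isHermitian (J : ℝ) : (siteHam J).IsHermitian := by
  rw [Matrix.IsHermitian, siteHam, Matrix.conjTranspose_add, Matrix.conjTranspose_mul,
    couplerOp_conjTranspose, couplerOp_conjTranspose, qubitOp_conjTranspose,
    couplerOp_mul_qubitOp, qubitOp_mul_couplerOp]
  simp only [couplerHm, couplerIm, Matrix.conjTranspose_smul, pauliX_conjTranspose,
    pauliZ_conjTranspose, star_trivial]

/-- A site Hamiltonian is block diagonal in the qubit basis. -/
lemma siteHam_apply (J : ℝ) (x y : Fin 2 × Fin 2) :
    siteHam J x y =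
      if x.1 = y.1 then (couplerHm J + zSign y.1 • couplerIm J) x.2 y.2 else 0 := by
  obtain ⟨a, c⟩ := x
  obtain ⟨b, d⟩ := y
  rw [siteHam, qubitOp_mul_couplerOp]
  fin_cases a <;> fin_cases b <;> simp [couplerOp, pauliZ, zSign]

lemma siteBasis_mul_conjTranspose {J : ℝ} (hJ : J ∈ Set.Ioo (0 : ℝ) 1) :
    siteBasis J * (siteBasis J)ᴴ = 1 := by
  ext ⟨a, c⟩ ⟨b, d⟩
  have h := fun e => congrFun (congrFun (couplerBasis_mul_conjTranspose hJ e) c) d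
  simp only [Matrix.mul_apply, Matrix.conjTranspose_apply] at h
  simp only [Matrix.mul_apply, Matrix.conjTranspose_apply, siteBasis, Matrix.of_apply,
    Fintype.sum_prod_type, Matrix.one_apply, Prod.mk.injEq]
  by_cases hab : a = b
  · subst hab
    rw [Finset.sum_eq_single a (fun e _ he => by simp [he.symm]) (by simp)]
    simpa [Matrix.one_apply] using h a
  · rw [if_neg (fun h => hab h.1)]
    refine Finset.sum_eq_zero fun e _ => Finset.sum_eq_zero fun k _ => ?_
    by_cases hae : a = e
    · subst hae; simp [Ne.symm hab]
    · simp [hae]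

lemma siteHam_mul_siteBasis {J : ℝ} (hJ : J ∈ Set.Ioo (0 : ℝ) 1) :
    siteHam J * siteBasis J =
      siteBasis J * Matrix.diagonal (fun x => (siteEnergy x : ℂ)) := by
  ext ⟨a, c⟩ ⟨b, k⟩
  have h := congrFun (congrFun (coupler_mul_couplerBasis hJ b) c) k
  rw [Matrix.mul_diagonal, Matrix.mul_apply] at h
  rw [Matrix.mul_diagonal, Matrix.mul_apply, Fintype.sum_prod_type]
  simp only [siteHam_apply, siteBasis, Matrix.of_apply]
  rw [Finset.sum_eq_single b (fun e _ he => by simp [he]) (by simp)]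
  by_cases hab : a = b
  · simpa [hab, siteEnergy] using h
  · simp [hab]

lemma siteIsometry_mul_conjTranspose (J : ℝ) :
    siteIsometry J * (siteIsometry J)ᴴ =
      siteBasis J * Matrix.diagonal (fun x => if x.2 = 0 then 1 else 0) * (siteBasis J)ᴴ := by
  ext x y
  rw [Matrix.mul_apply, Matrix.mul_apply, Fintype.sum_prod_type]
  simp [Matrix.mul_diagonal, siteBasis, siteIsometry, couplerBasis]

lemma siteIsometry_conjTranspose_mul {J : ℝ} (hJ : J ∈ Set.Ioo (0 : ℝ) 1) :
    (siteIsometry J)ᴴ * siteIsometry J = 1 := by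
  obtain ⟨p, q, h1, -, -, h0, h1'⟩ := exists_amplitudes hJ
  have h1 : (p : ℂ) ^ 2 + (q : ℂ) ^ 2 = 1 := by exact_mod_cast h1
  ext a b
  fin_cases a <;> fin_cases b <;>
    simp [Matrix.mul_apply, siteIsometry, Fintype.sum_prod_type, h0, h1'] <;> grind

lemma conj_qubitOp_pauliZ {J : ℝ} (hJ : J ∈ Set.Ioo (0 : ℝ) 1) :
    (siteIsometry J)ᴴ * qubitOp pauliZ * siteIsometry J = pauliZ := by
  obtain ⟨p, q, h1, -, -, h0, h1'⟩ := exists_amplitudes hJ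
  have h1 : (p : ℂ) ^ 2 + (q : ℂ) ^ 2 = 1 := by exact_mod_cast h1
  ext a b
  fin_cases a <;> fin_cases b <;>
    simp [Matrix.mul_apply, siteIsometry, Fintype.sum_prod_type, h0, h1', qubitOp, pauliZ,
      Matrix.one_apply] <;> grind

lemma conj_qubitOp_pauliX {J : ℝ} (hJ : J ∈ Set.Ioo (0 : ℝ) 1) :
    (siteIsometry J)ᴴ * qubitOp pauliX * siteIsometry J = √(1 - J ^ 2) • pauliX := by
  obtain ⟨p, q, h1, -, hF, h0, h1'⟩ := exists_amplitudes hJ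
  have hF' : (√(1 - J ^ 2) : ℂ) = 2 * p * q := by exact_mod_cast congrArg Complex.ofReal hF
  ext a b
  fin_cases a <;> fin_cases b <;>
    simp [Matrix.mul_apply, siteIsometry, Fintype.sum_prod_type, h0, h1', qubitOp, pauliX,
      Matrix.one_apply, hF'] <;> ring

lemma conj_couplerOp_pauliZ {J : ℝ} (hJ : J ∈ Set.Ioo (0 : ℝ) 1) :
    (siteIsometry J)ᴴ * couplerOp pauliZ * siteIsometry J = (-J) • pauliZ := by
  obtain ⟨p, q, h1, hJ, -, h0, h1'⟩ := exists_amplitudes hJ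
  have hJ' : (J : ℂ) = q ^ 2 - p ^ 2 := by exact_mod_cast congrArg Complex.ofReal hJ
  ext a b
  fin_cases a <;> fin_cases b <;>
    simp [Matrix.mul_apply, siteIsometry, Fintype.sum_prod_type, h0, h1', couplerOp, pauliZ,
      Matrix.one_apply, hJ'] <;> ring

lemma conj_couplerOp_pauliX {J : ℝ} (hJ : J ∈ Set.Ioo (0 : ℝ) 1) :
    (siteIsometry J)ᴴ * couplerOp pauliX * siteIsometry J =
      (-√(1 - J ^ 2)) • (1 : Matrix (Fin 2) (Fin 2) ℂ) := by
  obtain ⟨p, q, h1, -, hF, h0, h1'⟩ := exists_amplitudes hJ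
  have hF' : (√(1 - J ^ 2) : ℂ) = 2 * p * q := by exact_mod_cast congrArg Complex.ofReal hF
  ext a b
  fin_cases a <;> fin_cases b <;>
    simp [Matrix.mul_apply, siteIsometry, Fintype.sum_prod_type, h0, h1', couplerOp, pauliX,
      Matrix.one_apply, hF'] <;> ring

lemma conj_qubitOp_mul_couplerOp_pauliZ {J : ℝ} (hJ : J ∈ Set.Ioo (0 : ℝ) 1) :
    (siteIsometry J)ᴴ * (qubitOp pauliZ * couplerOp pauliZ) * siteIsometry J =
      (-J) • (1 : Matrix (Fin 2) (Fin 2) ℂ) := by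
  obtain ⟨p, q, h1, hJ, -, h0, h1'⟩ := exists_amplitudes hJ
  have hJ' : (J : ℂ) = q ^ 2 - p ^ 2 := by exact_mod_cast congrArg Complex.ofReal hJ
  rw [qubitOp_mul_couplerOp]
  ext a b
  fin_cases a <;> fin_cases b <;>
    simp [Matrix.mul_apply, siteIsometry, Fintype.sum_prod_type, h0, h1', pauliZ,
      hJ'] <;> ring

/-! ### The bare Hamiltonian and its ground space -/

section bare

variable {n : ℕ}

/-- The energy of the product eigenvector of the bare Hamiltonian labelled by `x`. -/
def bareEnergy (x : Fin n → Fin 2 × Fin 2) : ℝ := ∑ i, siteEnergy (x i)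

lemma siteEnergy_add_one_nonneg (x : Fin 2 × Fin 2) : 0 ≤ siteEnergy x + 1 := by
  unfold siteEnergy
  split_ifs <;> norm_num

lemma bareEnergy_add (x : Fin n → Fin 2 × Fin 2) :
    bareEnergy x + n = ∑ i, (siteEnergy (x i) + 1) := by
  simp [bareEnergy, Finset.sum_add_distrib]

lemma bareEnergy_of_forall {x : Fin n → Fin 2 × Fin 2} (h : ∀ i, (x i).2 = 0) :
    bareEnergy x = -n := by
  simp [bareEnergy, siteEnergy, h]

lemma le_bareEnergy_of_exists {x : Fin n → Fin 2 × Fin 2} (h : ∃ i, (x i).2 ≠ 0) :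
    -(n : ℝ) + 2 ≤ bareEnergy x := by
  obtain ⟨i, hi⟩ := h
  have h1 : siteEnergy (x i) + 1 ≤ ∑ i, (siteEnergy (x i) + 1) :=
    Finset.single_le_sum (f := fun i => siteEnergy (x i) + 1)
      (fun j _ => siteEnergy_add_one_nonneg (x j)) (Finset.mem_univ i)
  rw [← bareEnergy_add, siteEnergy, if_neg hi] at h1
  linarith

lemma isHermitian_sum {κ ι : Type} [Fintype κ] {A : κ → Matrix ι ι ℂ}
    (h : ∀ k, (A k).IsHermitian) : (∑ k, A k).IsHermitian := by
  rw [Matrix.IsHermitian, Matrix.conjTranspose_sum]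
  exact Finset.sum_congr rfl fun k _ => h k

lemma bareHam_isHermitian (n : ℕ) (J : ℝ) : (bareHam n J).IsHermitian :=
  isHermitian_sum fun i => by
    rw [Matrix.IsHermitian, siteOp_conjTranspose]
    exact congrArg (siteOp i) (siteHam_isHermitian J)

variable {J : ℝ}

lemma tensorOp_siteBasis_mul_conjTranspose (hJ : J ∈ Set.Ioo (0 : ℝ) 1) :
    tensorOp (fun _ : Fin n => siteBasis J) * (tensorOp fun _ : Fin n => siteBasis J)ᴴ = 1 := by
  rw [tensorOp_conjTranspose, tensorOp_mul]
  simp only [siteBasis_mul_conjTranspose hJ, tensorOp_one]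

lemma bareHam_mul_tensorOp_siteBasis (hJ : J ∈ Set.Ioo (0 : ℝ) 1) :
    bareHam n J * tensorOp (fun _ : Fin n => siteBasis J) =
      tensorOp (fun _ : Fin n => siteBasis J) *
        Matrix.diagonal (fun x => (bareEnergy x : ℂ)) := by
  have h1 : Matrix.diagonal (fun x : Fin n → Fin 2 × Fin 2 => (bareEnergy x : ℂ)) =
      ∑ i, siteOp i (Matrix.diagonal fun y => (siteEnergy y : ℂ)) := by
    simp only [siteOp_diagonal]
    ext x y
    simp [Matrix.sum_apply, Matrix.diagonal_apply, bareEnergy, Finset.sum_ite_irrel]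
  rw [h1, bareHam, Finset.sum_mul, Finset.mul_sum]
  refine Finset.sum_congr rfl fun i _ => ?_
  rw [siteOp_mul_tensorOp, tensorOp_mul_siteOp, ← siteHam_mul_siteBasis hJ]
  rfl

lemma spectrum_bareHam_subset (n : ℕ) (hJ : J ∈ Set.Ioo (0 : ℝ) 1) :
    spectrum ℝ (bareHam n J) ⊆ {-(n : ℝ)} ∪ Set.Ici (-(n : ℝ) + 2) := by
  refine (spectrum_subset_range_of_mul_eq_mul_diagonal (tensorOp_siteBasis_mul_conjTranspose hJ)
    bareEnergy (bareHam_mul_tensorOp_siteBasis hJ)).trans ?_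
  rintro _ ⟨x, rfl⟩
  by_cases h : ∀ i, (x i).2 = 0
  · exact Or.inl (bareEnergy_of_forall h)
  · exact Or.inr (le_bareEnergy_of_exists (not_forall.mp h))

lemma logicalBasis_eq_tensorOp (n : ℕ) (J : ℝ) :
    logicalBasis n J = tensorOp (fun _ : Fin n => siteIsometry J) := rfl

lemma logicalBasis_conjTranspose_mul (n : ℕ) (hJ : J ∈ Set.Ioo (0 : ℝ) 1) :
    (logicalBasis n J)ᴴ * logicalBasis n J = 1 := by
  rw [logicalBasis_eq_tensorOp, tensorOp_conjTranspose, tensorOp_mul]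
  simp only [siteIsometry_conjTranspose_mul hJ, tensorOp_one]

lemma logicalBasis_mul_conjTranspose (n : ℕ) (hJ : J ∈ Set.Ioo (0 : ℝ) 1) :
    logicalBasis n J * (logicalBasis n J)ᴴ = groundProj n J := by
  rw [groundProj, spectralProj, cfc_eq_of_mul_eq_mul_diagonal (bareHam_isHermitian n J)
    (tensorOp_siteBasis_mul_conjTranspose hJ) bareEnergy (bareHam_mul_tensorOp_siteBasis hJ)]
  have h1 : Matrix.diagonal (fun x : Fin n → Fin 2 × Fin 2 =>
      ((({-(n : ℝ)} : Set ℝ).indicator (fun _ => (1 : ℝ)) (bareEnergy x) : ℝ) : ℂ)) =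
      tensorOp (fun _ => Matrix.diagonal fun y : Fin 2 × Fin 2 => if y.2 = 0 then 1 else 0) := by
    rw [tensorOp_diagonal]
    congr 1
    funext x
    rw [Finset.prod_ite_zero]
    by_cases h : ∀ i, (x i).2 = 0
    · simp [h, bareEnergy_of_forall h]
    · have h2 := le_bareEnergy_of_exists (not_forall.mp h)
      have h3 : bareEnergy x ≠ -n := by linarith
      simp [h, h3]
  rw [h1, logicalBasis_eq_tensorOp, tensorOp_conjTranspose, tensorOp_conjTranspose, tensorOp_mul,
    tensorOp_mul, tensorOp_mul]
  simp only [siteIsometry_mul_conjTranspose]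

lemma siteOp_conjTranspose_mul_self {A : Matrix (Fin 2 × Fin 2) (Fin 2 × Fin 2) ℂ}
    (h : Aᴴ * A = 1) (i : Fin n) : (siteOp i A)ᴴ * siteOp i A = 1 := by
  rw [siteOp_conjTranspose, siteOp_mul_siteOp, h, siteOp_one]

lemma norm_groundProj_mul_siteOp (n : ℕ) (hJ : J ∈ Set.Ioo (0 : ℝ) 1) (i : Fin n) :
    ‖groundProj n J * siteOp i (couplerOp pauliZ)‖ = 1 := by
  have hP : IsStarProjection (groundProj n J) := isStarProjection_spectralProj _ _
  set Z := siteOp i (couplerOp pauliZ) with hZ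
  have hZ1 : Z * star Z = 1 := by
    refine mul_eq_one_comm.mp (siteOp_conjTranspose_mul_self ?_ i)
    rw [couplerOp_conjTranspose, couplerOp_mul_couplerOp, pauliZ_conjTranspose, pauliZ_mul_self,
      couplerOp_one]
  have hP0 : groundProj n J ≠ 0 := by
    intro h0
    have h1 := logicalBasis_conjTranspose_mul n hJ
    have h2 : logicalBasis n J = 0 := by
      calc logicalBasis n J = (logicalBasis n J * (logicalBasis n J)ᴴ) * logicalBasis n J := by
            rw [Matrix.mul_assoc, h1, Matrix.mul_one]
        _ = 0 := by rw [logicalBasis_mul_conjTranspose n hJ, h0, Matrix.zero_mul]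
    rw [h2, Matrix.mul_zero] at h1
    exact zero_ne_one h1
  have h1 : ‖groundProj n J * Z‖ * ‖groundProj n J * Z‖ = ‖groundProj n J‖ := by
    rw [← CStarRing.norm_self_mul_star, star_mul, mul_assoc, ← mul_assoc Z, hZ1, one_mul,
      hP.isSelfAdjoint.star_eq, hP.isIdempotentElem.eq]
  have h2 : ‖groundProj n J‖ * ‖groundProj n J‖ = ‖groundProj n J‖ := by
    rw [← CStarRing.norm_self_mul_star, hP.isSelfAdjoint.star_eq, hP.isIdempotentElem.eq]
  have h3 : ‖groundProj n J‖ = 1 := mul_left_cancel₀ (norm_ne_zero_iff.mpr hP0) (by rw [h2, mul_one])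
  rw [h3] at h1
  nlinarith [norm_nonneg (groundProj n J * Z)]

end bare

/-! ### Size of the perturbation and its compression to the ground space -/

section norms

variable {ι : Type} [Fintype ι] [DecidableEq ι]

lemma norm_real_smul (c : ℝ) (M : Matrix ι ι ℂ) : ‖c • M‖ = |c| * ‖M‖ := by
  have h : c • M = (c : ℂ) • M := by
    ext i j
    simp
  rw [h, norm_smul, Complex.norm_real, Real.norm_eq_abs]

lemma norm_real_smul_le {c b : ℝ} (hc : |c| ≤ b) {M : Matrix ι ι ℂ} (hM : ‖M‖ ≤ 1) :
    ‖c • M‖ ≤ b := by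
  rw [norm_real_smul]
  exact (mul_le_of_le_one_right (abs_nonneg c) hM).trans hc

lemma norm_sum_sites_le {n : ℕ} {M : Fin n → Matrix ι ι ℂ} {b : ℝ} (h : ∀ i, ‖M i‖ ≤ b) :
    ‖∑ i, M i‖ ≤ n * b := by
  refine (norm_sum_le_of_le _ fun i _ => h i).trans ?_
  simp

/-- A `d`-regular graph on `n` vertices has `n d / 2` edges. -/
lemma sum_edges_eq {n d : ℕ} (G : SimpleGraph (Fin n)) [DecidableRel G.Adj]
    (hG : G.IsRegularOfDegree d) (b : ℝ) :
    ∑ i, ∑ j, (if i < j ∧ G.Adj i j then b else 0) = n * (d / 2) * b := by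
  have h1 : ∑ i, ∑ j, (if i < j ∧ G.Adj i j then b else 0) =
      ∑ i, ∑ j, (if j < i ∧ G.Adj i j then b else 0) := by
    rw [Finset.sum_comm]
    simp only [G.adj_comm]
  have h2 : ∑ i, ∑ j, (if i < j ∧ G.Adj i j then b else 0) +
      ∑ i, ∑ j, (if j < i ∧ G.Adj i j then b else 0) = n * d * b := by
    have h3 : ∀ i, ∑ j, (if G.Adj i j then b else 0) = d * b := by
      intro i
      rw [← Finset.sum_filter, Finset.sum_const, ← SimpleGraph.neighborFinset_eq_filter,
        SimpleGraph.card_neighborFinset_eq_degree, hG i, nsmul_eq_mul]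
    calc _ = ∑ i, ∑ j, (if G.Adj i j then b else 0) := by
          simp only [← Finset.sum_add_distrib]
          refine Finset.sum_congr rfl fun i _ => Finset.sum_congr rfl fun j _ => ?_
          by_cases hij : G.Adj i j
          · rcases lt_or_gt_of_ne hij.ne with h | h
            · simp [hij, h, h.not_gt]
            · simp [hij, h, h.not_gt]
          · simp [hij]
      _ = n * d * b := by simp [h3, mul_assoc]
  rw [← h1] at h2
  linarith

lemma norm_sum_edges_le {n d : ℕ} (G : SimpleGraph (Fin n)) [DecidableRel G.Adj]
    (hG : G.IsRegularOfDegree d) {M : Fin n → Fin n → Matrix ι ι ℂ} {b : ℝ}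
    (h : ∀ i j, ‖M i j‖ ≤ b) :
    ‖∑ i, ∑ j, (if i < j ∧ G.Adj i j then M i j else 0)‖ ≤ n * (d / 2) * b := by
  rw [← sum_edges_eq G hG]
  refine norm_sum_le_of_le _ fun i _ => norm_sum_le_of_le _ fun j _ => ?_
  split_ifs
  · exact h i j
  · simp

end norms

section perturbation

variable {n : ℕ}

lemma norm_siteOp_le_one {κ : Type} [Fintype κ] [DecidableEq κ] {A : Matrix κ κ ℂ}
    (h : Aᴴ * A = 1) (i : Fin n) : ‖siteOp i A‖ ≤ 1 :=
  norm_le_one_of_conjTranspose_mul_self (by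
    rw [siteOp_conjTranspose, siteOp_mul_siteOp, h, siteOp_one])

lemma qubitOp_conjTranspose_mul_self {A : Matrix (Fin 2) (Fin 2) ℂ} (h : Aᴴ * A = 1) :
    (qubitOp A)ᴴ * qubitOp A = 1 := by
  rw [qubitOp_conjTranspose, qubitOp_mul_qubitOp, h, qubitOp_one]

lemma couplerOp_conjTranspose_mul_self {A : Matrix (Fin 2) (Fin 2) ℂ} (h : Aᴴ * A = 1) :
    (couplerOp A)ᴴ * couplerOp A = 1 := by
  rw [couplerOp_conjTranspose, couplerOp_mul_couplerOp, h, couplerOp_one]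

lemma pauliX_conjTranspose_mul_self : pauliXᴴ * pauliX = 1 := by
  rw [pauliX_conjTranspose, pauliX_mul_self]

lemma pauliZ_conjTranspose_mul_self : pauliZᴴ * pauliZ = 1 := by
  rw [pauliZ_conjTranspose, pauliZ_mul_self]

lemma zz_conjTranspose_mul_self :
    (qubitOp pauliZ * couplerOp pauliZ)ᴴ * (qubitOp pauliZ * couplerOp pauliZ) = 1 := by
  rw [Matrix.conjTranspose_mul, Matrix.mul_assoc, ← Matrix.mul_assoc (qubitOp pauliZ)ᴴ,
    qubitOp_conjTranspose_mul_self pauliZ_conjTranspose_mul_self, Matrix.one_mul,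
    couplerOp_conjTranspose_mul_self pauliZ_conjTranspose_mul_self]

lemma isHermitian_real_smul {ι : Type} {M : Matrix ι ι ℂ} (h : M.IsHermitian) (c : ℝ) :
    (c • M).IsHermitian := by
  rw [Matrix.IsHermitian, Matrix.conjTranspose_smul, h, star_trivial]

lemma siteOp_isHermitian {κ : Type} [DecidableEq κ] {A : Matrix κ κ ℂ} (h : A.IsHermitian)
    (i : Fin n) : (siteOp i A).IsHermitian := by
  rw [Matrix.IsHermitian, siteOp_conjTranspose, h]

lemma siteOp_commute {κ : Type} [Fintype κ] [DecidableEq κ] {i j : Fin n} (hij : i ≠ j)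
    (A B : Matrix κ κ ℂ) : siteOp i A * siteOp j B = siteOp j B * siteOp i A := by
  rw [siteOp_eq_tensorOp j, siteOp_mul_tensorOp, tensorOp_mul_siteOp]
  simp [Function.update_of_ne hij]

lemma perturbation_isHermitian (G : SimpleGraph (Fin n)) [DecidableRel G.Adj]
    (hc tc : Fin n → ℝ) (f : Fin n → Fin n → ℝ) (δJ δΩ : Fin n → ℝ) :
    (perturbation G hc tc f δJ δΩ).IsHermitian := by
  have hq : ∀ {A : Matrix (Fin 2) (Fin 2) ℂ}, A.IsHermitian → (qubitOp A).IsHermitian :=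
    fun {A} h => by rw [Matrix.IsHermitian, qubitOp_conjTranspose, h]
  have hc : ∀ {A : Matrix (Fin 2) (Fin 2) ℂ}, A.IsHermitian → (couplerOp A).IsHermitian :=
    fun {A} h => by rw [Matrix.IsHermitian, couplerOp_conjTranspose, h]
  have hZ : pauliZ.IsHermitian := pauliZ_conjTranspose
  have hX : pauliX.IsHermitian := pauliX_conjTranspose
  have hZZ : (qubitOp pauliZ * couplerOp pauliZ).IsHermitian := by
    rw [Matrix.IsHermitian, Matrix.conjTranspose_mul, hq hZ, hc hZ, couplerOp_mul_qubitOp,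
      qubitOp_mul_couplerOp]
  refine (isHermitian_sum fun i => ?_).add (isHermitian_sum fun i => isHermitian_sum fun j => ?_)
  · exact (((isHermitian_real_smul (siteOp_isHermitian (hq hZ) i) _).add
      (isHermitian_real_smul (siteOp_isHermitian (hq hX) i) _)).add
      (isHermitian_real_smul (siteOp_isHermitian hZZ i) _)).add
      (isHermitian_real_smul (siteOp_isHermitian (hc hX) i) _)
  · split_ifs with h
    · refine isHermitian_real_smul ?_ _
      rw [Matrix.IsHermitian, Matrix.conjTranspose_mul, siteOp_isHermitian (hc hZ),
        siteOp_isHermitian (hc hZ), siteOp_commute h.1.ne]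
    · exact Matrix.isHermitian_zero

lemma norm_perturbation_le {d : ℕ} (G : SimpleGraph (Fin n)) [DecidableRel G.Adj]
    (hG : G.IsRegularOfDegree d) {hc tc : Fin n → ℝ} {f : Fin n → Fin n → ℝ} {δJ δΩ : Fin n → ℝ}
    {bh bt bf δ : ℝ} (hh : ∀ i, |hc i| ≤ bh) (ht : ∀ i, |tc i| ≤ bt) (hf : ∀ i j, |f i j| ≤ bf)
    (hJ : ∀ i, |δJ i| ≤ δ) (hΩ : ∀ i, |δΩ i| ≤ δ) :
    ‖perturbation G hc tc f δJ δΩ‖ ≤ n * (bh + bt + δ + δ) + n * (d / 2) * bf := by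
  refine (norm_add_le _ _).trans (add_le_add (norm_sum_sites_le fun i => ?_)
    (norm_sum_edges_le G hG fun i j => ?_))
  · refine (norm_add₄_le).trans (add_le_add (add_le_add (add_le_add ?_ ?_) ?_) ?_)
    · exact norm_real_smul_le (hh i) (norm_siteOp_le_one
        (qubitOp_conjTranspose_mul_self pauliZ_conjTranspose_mul_self) i)
    · exact norm_real_smul_le (ht i) (norm_siteOp_le_one
        (qubitOp_conjTranspose_mul_self pauliX_conjTranspose_mul_self) i)
    · exact norm_real_smul_le (hJ i) (norm_siteOp_le_one zz_conjTranspose_mul_self i)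
    · exact norm_real_smul_le (hΩ i) (norm_siteOp_le_one
        (couplerOp_conjTranspose_mul_self pauliX_conjTranspose_mul_self) i)
  · have hZ := fun k : Fin n => norm_siteOp_le_one
      (couplerOp_conjTranspose_mul_self pauliZ_conjTranspose_mul_self) k
    refine norm_real_smul_le (hf i j) ((norm_mul_le _ _).trans ?_)
    exact mul_le_one₀ (hZ i) (norm_nonneg _) (hZ j)

/-- In the logical basis, the compression of the perturbation to the ground space replaces `X` by
`√(1 - J²) X` and `Z_qc` by `-J Z`, while `Z Z_qc` and `X_qc` become constants. -/
lemma conj_perturbation {J : ℝ} (hJ : J ∈ Set.Ioo (0 : ℝ) 1) (G : SimpleGraph (Fin n))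
    [DecidableRel G.Adj] (hc tc : Fin n → ℝ) (f : Fin n → Fin n → ℝ) (δJ δΩ : Fin n → ℝ) :
    (logicalBasis n J)ᴴ * perturbation G hc tc f δJ δΩ * logicalBasis n J =
      (∑ i, (hc i • siteOp i pauliZ + (tc i * √(1 - J ^ 2)) • siteOp i pauliX -
          (δJ i * J) • 1 - (δΩ i * √(1 - J ^ 2)) • 1)) +
        ∑ i, ∑ j, if i < j ∧ G.Adj i j then
          (f i j * (J * J)) • (siteOp i pauliZ * siteOp j pauliZ) else 0 := by
  have hw := siteIsometry_conjTranspose_mul hJ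
  have h1 : ∀ (i : Fin n) (A : Matrix (Fin 2 × Fin 2) (Fin 2 × Fin 2) ℂ),
      (logicalBasis n J)ᴴ * siteOp i A * logicalBasis n J =
        siteOp i ((siteIsometry J)ᴴ * A * siteIsometry J) := fun i A => by
    rw [logicalBasis_eq_tensorOp, conj_siteOp _ hw]
  rw [perturbation, Matrix.mul_add, Matrix.add_mul, Matrix.mul_sum, Matrix.sum_mul, Matrix.mul_sum,
    Matrix.sum_mul]
  congr 1
  · refine Finset.sum_congr rfl fun i _ => ?_
    simp only [Matrix.mul_add, Matrix.add_mul, Matrix.mul_smul, Matrix.smul_mul, h1,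
      conj_qubitOp_pauliZ hJ, conj_qubitOp_pauliX hJ, conj_couplerOp_pauliX hJ,
      conj_qubitOp_mul_couplerOp_pauliZ hJ, siteOp_smul, siteOp_one, smul_smul]
    simp only [mul_neg, neg_smul, sub_eq_add_neg]
  · refine Finset.sum_congr rfl fun i _ => ?_
    rw [Matrix.mul_sum, Matrix.sum_mul]
    refine Finset.sum_congr rfl fun j _ => ?_
    split_ifs with h
    · rw [Matrix.mul_smul, Matrix.smul_mul, logicalBasis_eq_tensorOp,
        conj_siteOp_mul_siteOp _ hw h.1.ne, conj_couplerOp_pauliZ hJ, siteOp_smul, siteOp_smul,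
        Matrix.smul_mul, Matrix.mul_smul, smul_smul, smul_smul]
      congr 1
      ring
    · simp

/-- To first order the gadget implements the target Hamiltonian exactly, except for the control
errors. -/
lemma norm_conj_perturbation_sub_le {d : ℕ} {J : ℝ} (hJ : J ∈ Set.Ioo (0 : ℝ) 1)
    (G : SimpleGraph (Fin n)) [DecidableRel G.Adj] (hG : G.IsRegularOfDegree d)
    (Jt : Fin n → Fin n → ℝ) (h t : Fin n → ℝ) {δh δt δJ δΩ : Fin n → ℝ}
    {δf : Fin n → Fin n → ℝ} {δ : ℝ} (hδh : ∀ i, |δh i| ≤ δ) (hδt : ∀ i, |δt i| ≤ δ)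
    (hδJ : ∀ i, |δJ i| ≤ δ) (hδΩ : ∀ i, |δΩ i| ≤ δ) (hδf : ∀ i j, |δf i j| ≤ δ) (α : ℝ) :
    ‖(logicalBasis n J)ᴴ * perturbation G (fun i => α * h i + δh i)
        (fun i => α * (√(1 - J ^ 2))⁻¹ * t i + δt i) (fun i j => α * Jt i j / (J * J) + δf i j)
        δJ δΩ * logicalBasis n J - α • targetHam G Jt h t‖ ≤
      n * (δ + δ * √(1 - J ^ 2) + δ * J + δ * √(1 - J ^ 2)) + n * (d / 2) * (δ * (J * J)) := by
  have hJ0 : J ≠ 0 := hJ.1.ne'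
  have hF : 0 < √(1 - J ^ 2) := Real.sqrt_pos.mpr (by nlinarith [hJ.1, hJ.2])
  set F := √(1 - J ^ 2) with hFdef
  have hdiff : (logicalBasis n J)ᴴ * perturbation G (fun i => α * h i + δh i)
        (fun i => α * F⁻¹ * t i + δt i) (fun i j => α * Jt i j / (J * J) + δf i j)
        δJ δΩ * logicalBasis n J - α • targetHam G Jt h t =
      (∑ i, (δh i • siteOp i pauliZ + (δt i * F) • siteOp i pauliX +
          (-(δJ i * J)) • 1 + (-(δΩ i * F)) • 1)) +
        ∑ i, ∑ j, if i < j ∧ G.Adj i j then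
          (δf i j * (J * J)) • (siteOp i pauliZ * siteOp j pauliZ) else 0 := by
    rw [conj_perturbation hJ, ← hFdef, targetHam, smul_add, Finset.smul_sum, Finset.smul_sum,
      add_comm (∑ i, α • _), add_sub_add_comm, ← Finset.sum_sub_distrib, ← Finset.sum_sub_distrib]
    congr 1
    · refine Finset.sum_congr rfl fun i _ => ?_
      have : (α * F⁻¹ * t i + δt i) * F = α * t i + δt i * F := by
        field_simp
      rw [this]
      module
    · refine Finset.sum_congr rfl fun i _ => ?_
      rw [Finset.smul_sum, ← Finset.sum_sub_distrib]
      refine Finset.sum_congr rfl fun j _ => ?_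
      split_ifs
      · have : (α * Jt i j / (J * J) + δf i j) * (J * J) = α * Jt i j + δf i j * (J * J) := by
          field_simp
        rw [this]
        module
      · simp
  have habs : ∀ {x b : ℝ}, |x| ≤ δ → 0 ≤ b → |x * b| ≤ δ * b := fun {x b} hx hb => by
    rw [abs_mul, abs_of_nonneg hb]
    gcongr
  have h1 : ‖(1 : Matrix (Fin n → Fin 2) (Fin n → Fin 2) ℂ)‖ ≤ 1 :=
    norm_star_projection_le (.one _)
  have hX := fun k : Fin n => norm_siteOp_le_one pauliX_conjTranspose_mul_self k
  have hZ := fun k : Fin n => norm_siteOp_le_one pauliZ_conjTranspose_mul_self k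
  rw [hdiff]
  refine (norm_add_le _ _).trans (add_le_add (norm_sum_sites_le fun i => ?_)
    (norm_sum_edges_le G hG fun i j => ?_))
  · refine (norm_add₄_le).trans (add_le_add (add_le_add (add_le_add ?_ ?_) ?_) ?_)
    · exact norm_real_smul_le (hδh i) (hZ i)
    · exact norm_real_smul_le (habs (hδt i) hF.le) (hX i)
    · exact norm_real_smul_le (by rw [abs_neg]; exact habs (hδJ i) hJ.1.le) h1
    · exact norm_real_smul_le (by rw [abs_neg]; exact habs (hδΩ i) hF.le) h1
  · refine norm_real_smul_le (habs (hδf i j) (mul_self_nonneg J)) ((norm_mul_le _ _).trans ?_)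
    exact mul_le_one₀ (hZ i) (norm_nonneg _) (hZ j)

end perturbation

/-! ### The error budget -/

/-- The response sum `1 + 1/F + s J⁻²` times the precision sum `3 + F + s J²` is at least `s² + 4 s`,
so the control errors enlarge the perturbation by at most the fraction `ε / 4`. -/
lemma sq_add_le_response_mul_precision {s F J : ℝ} (hs : 0 ≤ s) (hF : 0 < F) (hF1 : F ≤ 1)
    (hJ : 0 < J) (hJ1 : J ≤ 1) :
    s ^ 2 + 4 * s ≤ (1 + F⁻¹ + s * (J ^ 2)⁻¹) * (3 + F + s * J ^ 2) := by
  have hf : 1 ≤ F⁻¹ := (one_le_inv₀ hF).mpr hF1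
  have hj : 1 ≤ (J ^ 2)⁻¹ := (one_le_inv₀ (by positivity)).mpr (by nlinarith)
  set f := F⁻¹ with hfdef
  set j := (J ^ 2)⁻¹ with hjdef
  have h1 : F * f = 1 := mul_inv_cancel₀ hF.ne'
  have h2 : J ^ 2 * j = 1 := mul_inv_cancel₀ (by positivity)
  have h3 : 1 ≤ j * F + f * J ^ 2 := by
    have h4 : (j * F) * (f * J ^ 2) = 1 := by linear_combination (J ^ 2 * j) * h1 + h2
    have h5 : 0 < j * F := by positivity
    have h6 : 0 < f * J ^ 2 := by positivity
    nlinarith [sq_nonneg (j * F - f * J ^ 2)]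
  have h7 : (1 + f + s * j) * (3 + F + s * J ^ 2) =
      3 + F + s * J ^ 2 + 3 * f + 1 + s * (j * F + f * J ^ 2) + 3 * s * j + s ^ 2 := by
    linear_combination h1 + s ^ 2 * h2
  rw [h7]
  have h8 : s * 1 ≤ s * (j * F + f * J ^ 2) := by gcongr
  have h9 : s * 1 ≤ s * j := by gcongr
  have h10 : 0 ≤ s * J ^ 2 := by positivity
  linarith

section budget

variable {n s ε F J A B α δ : ℝ}

/-- The bound `v` on the norm of the perturbation exceeds its error-free part by the factor
`1 + 7/64`, where `7/64` bounds `ε / 4`. -/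
lemma norm_budget (hn : 0 < n) (hs : 0 < s) (hε' : ε ≤ 7 / 16)
    (hA : A = 1 + F⁻¹ + s * (J ^ 2)⁻¹) (hB : 0 < B)
    (hAB : s ^ 2 + 4 * s ≤ A * B) (hα : 0 < α) (hδ : δ ≤ α * (s * ε / (4 * B))) :
    n * ((α + δ) + (α * F⁻¹ + δ) + δ + δ) + n * s * (α * (J ^ 2)⁻¹ + δ) ≤
      71 / 64 * (n * α * A) := by
  have h1 : δ * (4 + s) ≤ 7 / 64 * (α * A) := by
    have h2 : s * ε / (4 * B) * (4 + s) ≤ 7 / 64 * A := by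
      rw [div_mul_eq_mul_div, div_le_iff₀ (by positivity)]
      have h3 : ε * (s ^ 2 + 4 * s) ≤ 7 / 16 * (A * B) := by gcongr
      nlinarith
    calc δ * (4 + s) ≤ α * (s * ε / (4 * B)) * (4 + s) := by gcongr
      _ = α * (s * ε / (4 * B) * (4 + s)) := by ring
      _ ≤ α * (7 / 64 * A) := by gcongr
      _ = 7 / 64 * (α * A) := by ring
  have h4 : n * ((α + δ) + (α * F⁻¹ + δ) + δ + δ) + n * s * (α * (J ^ 2)⁻¹ + δ) =
      n * (α * A + δ * (4 + s)) := by rw [hA]; ring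
  rw [h4]
  calc n * (α * A + δ * (4 + s)) ≤ n * (α * A + 7 / 64 * (α * A)) := by gcongr
    _ = 71 / 64 * (n * α * A) := by ring

lemma small_budget (hn : 0 < n) (hs : 0 < s) (hε' : ε ≤ 7 / 16) (hA0 : 0 < A)
    (hAs : s ≤ A) (hα : α = s * ε * 0.95 / (3 * 7 * n * A ^ 2)) :
    71 / 64 * (n * α * A) ≤ 1 / 40 := by
  have h1 : n * α * A = 0.95 / 21 * (s * ε) / A := by
    rw [hα]; field_simp; ring
  have h2 : s * ε ≤ 7 / 16 * A := by nlinarith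
  have h3 : n * α * A ≤ 0.95 / 21 * (7 / 16) := by
    rw [h1, div_le_iff₀ hA0]
    nlinarith
  norm_num at h3 ⊢
  linarith

/-- The first-order error takes a quarter of the admissible error, the second-order error less than
the remaining three quarters. -/
lemma error_budget (hn : 0 < n) (hs : 0 < s) (hε : 0 < ε) (hA0 : 0 < A) (hF1 : F ≤ 1) (hJ1 : J ≤ 1)
    (hB : B = 3 + F + s * J ^ 2) (hB0 : 0 < B) (hδ0 : 0 ≤ δ)
    (hα : α = s * ε * 0.95 / (3 * 7 * n * A ^ 2)) (hδ : δ ≤ α * (s * ε / (4 * B))) :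
    10 * (71 / 64 * (n * α * A)) ^ 2 +
      (n * (δ + δ * F + δ * J + δ * F) + n * s * (δ * (J * J))) ≤ α * (ε * n * s) := by
  have hα0 : 0 < α := by rw [hα]; positivity
  have h1 : n * (δ + δ * F + δ * J + δ * F) + n * s * (δ * (J * J)) ≤ n * (δ * B) := by
    have h2 : n * (δ + δ * F + δ * J + δ * F) + n * s * (δ * (J * J)) =
        n * (δ * (1 + F + J + F + s * J ^ 2)) := by ring
    rw [h2, hB]
    gcongr
    linarith
  have h3 : n * (δ * B) ≤ 1 / 4 * (α * (ε * n * s)) := by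
    calc n * (δ * B) ≤ n * (α * (s * ε / (4 * B)) * B) := by gcongr
      _ = 1 / 4 * (α * (ε * n * s)) := by field_simp
  have h4 : (n * α * A) ^ 2 = 0.95 / 21 * (α * (ε * n * s)) := by
    have h5 : n * α * A ^ 2 = 0.95 / 21 * (s * ε) := by
      rw [hα]; field_simp; norm_num
    calc (n * α * A) ^ 2 = n * α * (n * α * A ^ 2) := by ring
      _ = 0.95 / 21 * (α * (ε * n * s)) := by rw [h5]; ring
  have h6 : 0 < α * (ε * n * s) := by positivity
  rw [mul_pow, h4]
  norm_num
  linarith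

end budget

/-! ### The gadget -/

section gadget

variable {ι : Type} [Fintype ι] [DecidableEq ι]

open scoped MatrixOrder in
/-- A perturbation of norm at most `v` is dominated by `v (1 + K)` for every positive `K`. -/
lemma posSemidef_smul_one_add_add {K V : Matrix ι ι ℂ} {v : ℝ} (hK : K.PosSemidef)
    (hV : V.IsHermitian) (hv : ‖V‖ ≤ v) : (v • (1 + K) + V).PosSemidef := by
  have hv0 : 0 ≤ v := (norm_nonneg V).trans hv
  have h1 : 0 ≤ algebraMap ℝ (Matrix ι ι ℂ) v + V := by
    have h2 : -algebraMap ℝ (Matrix ι ι ℂ) ‖V‖ ≤ V :=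
      (IsSelfAdjoint.neg_algebraMap_norm_le_self (a := V) hV.isSelfAdjoint)
    have h3 : algebraMap ℝ (Matrix ι ι ℂ) ‖V‖ ≤ algebraMap ℝ (Matrix ι ι ℂ) v :=
      algebraMap_mono _ hv
    have h4 : -algebraMap ℝ (Matrix ι ι ℂ) v ≤ V := (neg_le_neg h3).trans h2
    exact neg_le_iff_add_nonneg'.mp h4
  have h5 : v • (1 + K) + V = (algebraMap ℝ (Matrix ι ι ℂ) v + V) + v • K := by
    rw [Algebra.algebraMap_eq_smul_one, smul_add]
    abel
  rw [h5]
  exact (Matrix.nonneg_iff_posSemidef.mp h1).add (hK.smul hv0)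

lemma posSemidef_bareHam_add (n : ℕ) {J : ℝ} (hJ : J ∈ Set.Ioo (0 : ℝ) 1) :
    (bareHam n J + (n : ℝ) • 1).PosSemidef := by
  have h1 : bareHam n J + (n : ℝ) • 1 = bareHam n J - (-(n : ℝ)) • 1 := by
    rw [neg_smul, sub_neg_eq_add]
  rw [h1, ← cfc_sub_const (bareHam_isHermitian n J)]
  open scoped MatrixOrder in
  refine Matrix.nonneg_iff_posSemidef.mp (cfc_nonneg fun x hx => ?_)
  rcases spectrum_bareHam_subset n hJ hx with h | h
  · rw [Set.mem_singleton_iff.mp h, sub_self]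
  · linarith [Set.mem_Ici.mp h]

/-- The norm of the perturbation is at most `v = 71/64 n α A ≤ 1/40`, where `A = 1 + 1/F + s J⁻²`. On
the ground space, its compression misses the reduced target Hamiltonian by at most a quarter of
the admissible error, and the rotated Hamiltonian misses the compression by at most `10 v²`. -/
theorem gadgetReproduces_of_le {n d : ℕ} (hn : 0 < n) (hd : 0 < d) {ε : ℝ} (hε : 0 < ε)
    (hε' : ε ≤ 7 / 16) {J : ℝ} (hJ : J ∈ Set.Ioo (0 : ℝ) 1) {δ : ℝ}
    (hδ : δ ≤ controlBound n ((d : ℝ) / 2) ε J) : GadgetReproduces n d J ε δ := by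
  intro G _ hG Jt h t hJt hh ht δh δt δJ δΩ δf hδh hδt hδJ hδΩ hδf s α H₀ V P P' W
  have hn' : (0 : ℝ) < n := Nat.cast_pos.mpr hn
  have hs : 0 < s := by positivity
  have hJ0 := hJ.1
  have hJ1 := hJ.2
  have hδ0 : 0 ≤ δ := (abs_nonneg _).trans (hδh ⟨0, hn⟩)
  set F := √(1 - J ^ 2) with hF
  have hF0 : 0 < F := Real.sqrt_pos.mpr (by nlinarith)
  have hF1 : F ≤ 1 := Real.sqrt_le_one.mpr (by nlinarith)
  set A := 1 + F⁻¹ + s * (J ^ 2)⁻¹ with hA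
  set B := 3 + F + s * J ^ 2 with hB
  have hA0 : 0 < A := by positivity
  have hB0 : 0 < B := by positivity
  have hAs : s ≤ A := by
    have h1 : 1 ≤ (J ^ 2)⁻¹ := (one_le_inv₀ (by positivity)).mpr (by nlinarith)
    have h2 : s * 1 ≤ s * (J ^ 2)⁻¹ := by gcongr
    have h3 : 0 < F⁻¹ := by positivity
    linarith
  have hα : α = s * ε * 0.95 / (3 * 7 * n * A ^ 2) := rfl
  have hα0 : 0 < α := by rw [hα]; positivity
  have hδ' : δ ≤ α * (s * ε / (4 * B)) := by
    refine hδ.trans_eq ?_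
    change (s * ε) ^ 2 * 0.95 * B⁻¹ / (12 * 7 * n * A ^ 2) = _
    rw [hα]
    field_simp
    norm_num
  set v := 71 / 64 * (n * α * A) with hv
  have hV : V.IsHermitian := perturbation_isHermitian _ _ _ _ _ _
  have habs : ∀ {x e a b : ℝ}, 0 ≤ a → |x| ≤ 1 → |e| ≤ δ → b = a * x + e → |b| ≤ a + δ := by
    rintro x e a b ha hx he rfl
    refine (abs_add_le _ _).trans (add_le_add ?_ he)
    rw [abs_mul, abs_of_nonneg ha]
    exact mul_le_of_le_one_right ha hx
  have hVn : ‖V‖ ≤ v := by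
    refine (norm_perturbation_le G hG (bh := α + δ) (bt := α * F⁻¹ + δ)
      (bf := α * (J ^ 2)⁻¹ + δ) (fun i => ?_) (fun i => ?_) (fun i j => ?_) hδJ hδΩ).trans
      (norm_budget hn' hs hε' hA hB0
        (sq_add_le_response_mul_precision hs.le hF0 hF1 hJ0 hJ1.le) hα0 hδ')
    · exact habs hα0.le (hh i) (hδh i) rfl
    · exact habs (by positivity) (ht i) (hδt i) rfl
    · exact habs (by positivity) (hJt i j) (hδf i j) (by rw [← sq, div_eq_mul_inv]; ring)
  have hv40 : v ≤ 1 / 40 := small_budget hn' hs hε' hA0 hAs hα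
  have hspec := spectrum_bareHam_subset n hJ
  refine ⟨⟨v, ?_, posSemidef_smul_one_add_add (posSemidef_bareHam_add n hJ) hV hVn, ?_, ?_⟩, ?_⟩
  · rw [sub_eq_add_neg]
    exact posSemidef_smul_one_add_add (posSemidef_bareHam_add n hJ) hV.neg (by rwa [norm_neg])
  · norm_num [adjGap]
    linarith
  · refine (spectrum_add_subset (bareHam_isHermitian n J) hspec zero_le_two hVn).trans
      (Set.union_subset_union_right _ (Set.Ici_subset_Ici.mpr ?_))
    norm_num [adjGap]
    linarith
  · obtain ⟨U, hU, hUP, hcomm, herr⟩ := exists_schriefferWolff_block (bareHam_isHermitian n J) hV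
      hspec hVn hv40 (c := adjGap / 2) (by norm_num [adjGap]; linarith) (by norm_num [adjGap])
    refine ⟨U, hU, hUP, hcomm, ?_⟩
    change ‖P * (U * (H₀ + V - (-(n : ℝ)) • 1) * Uᴴ) * P - P * V * P‖ ≤ _ at herr
    rw [neg_smul, sub_neg_eq_add] at herr
    have hWW : Wᴴ * W = 1 := logicalBasis_conjTranspose_mul n hJ
    have hPW : P * W = W := by
      have h1 : W * Wᴴ = P := logicalBasis_mul_conjTranspose n hJ
      rw [← h1, Matrix.mul_assoc, hWW, Matrix.mul_one]
    have hWP : Wᴴ * P = Wᴴ := by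
      have h1 : W * Wᴴ = P := logicalBasis_mul_conjTranspose n hJ
      rw [← h1, ← Matrix.mul_assoc, hWW, Matrix.one_mul]
    have hWn : ‖W‖ ≤ 1 := norm_le_one_of_conjTranspose_mul_self hWW
    have hWn' : ‖Wᴴ‖ ≤ 1 := by rwa [Matrix.l2_opNorm_conjTranspose]
    have hcompress : ∀ M : Matrix (Fin n → Fin 2 × Fin 2) (Fin n → Fin 2 × Fin 2) ℂ,
        Wᴴ * (P * M * P) * W = Wᴴ * M * W := fun M => by
      calc Wᴴ * (P * M * P) * W = (Wᴴ * P) * M * (P * W) := by simp only [Matrix.mul_assoc]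
        _ = Wᴴ * M * W := by rw [hPW, hWP]
    set M := U * (H₀ + V + (n : ℝ) • 1) * Uᴴ with hM
    have hsecond : ‖Wᴴ * M * W - Wᴴ * V * W‖ ≤ 10 * v ^ 2 := by
      rw [← hcompress M, ← hcompress V, ← Matrix.sub_mul, ← Matrix.mul_sub]
      calc ‖Wᴴ * (P * M * P - P * V * P) * W‖
          ≤ ‖Wᴴ * (P * M * P - P * V * P)‖ * ‖W‖ := Matrix.l2_opNorm_mul _ _
        _ ≤ (‖Wᴴ‖ * ‖P * M * P - P * V * P‖) * ‖W‖ := by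
            gcongr
            exact Matrix.l2_opNorm_mul _ _
        _ ≤ (1 * (10 * v ^ 2)) * 1 := by gcongr
        _ = 10 * v ^ 2 := by ring
    have hfirst := norm_conj_perturbation_sub_le hJ G hG Jt h t hδh hδt hδJ hδΩ hδf α
    calc ‖Wᴴ * M * W - α • targetHam G Jt h t‖
        ≤ ‖Wᴴ * M * W - Wᴴ * V * W‖ + ‖Wᴴ * V * W - α • targetHam G Jt h t‖ :=
          norm_sub_le_norm_sub_add_norm_sub _ _ _
      _ ≤ _ := add_le_add hsecond hfirst
      _ ≤ α * (ε * n * s) := error_budget hn' hs hε hA0 hF1 hJ1.le hB hB0 hδ0 hα hδ'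

end gadget

/-! ### The best coupling strength -/

/-- The bound on the control error, up to its dependence on `n` and `ε`. The numerator and
denominator of `1 + 1/F + s J⁻²` are cleared, which makes it continuous on `[0, 1]`. -/
noncomputable def precisionProfile (s J : ℝ) : ℝ :=
  (√(1 - J ^ 2) * J ^ 2 / (√(1 - J ^ 2) * J ^ 2 + J ^ 2 + s * √(1 - J ^ 2))) ^ 2 /
    (3 + √(1 - J ^ 2) + s * J ^ 2)

lemma controlBound_eq_precisionProfile {n : ℕ} {s ε J : ℝ} (hn : 0 < n) (hs : 0 < s)
    (hJ : J ∈ Set.Ioo (0 : ℝ) 1) :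
    controlBound n s ε J = s ^ 2 * 0.95 / 84 * precisionProfile s J * ε ^ 2 / n := by
  have hJ0 := hJ.1
  have hF0 : 0 < √(1 - J ^ 2) := Real.sqrt_pos.mpr (by nlinarith [hJ.2])
  have hn' : (0 : ℝ) < n := Nat.cast_pos.mpr hn
  rw [controlBound, precisionProfile, adjGap]
  field_simp
  ring

lemma precisionProfile_denominator_pos {s J : ℝ} (hs : 0 < s) (hJ : J ∈ Set.Icc (0 : ℝ) 1) :
    0 < √(1 - J ^ 2) * J ^ 2 + J ^ 2 + s * √(1 - J ^ 2) := by
  have hF := Real.sqrt_nonneg (1 - J ^ 2)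
  rcases hJ.1.eq_or_lt with h | h
  · rw [← h]
    simpa using hs
  · positivity

lemma exists_isMaxOn_precisionProfile {s : ℝ} (hs : 0 < s) :
    ∃ J ∈ Set.Ioo (0 : ℝ) 1, 0 < precisionProfile s J ∧
      IsMaxOn (precisionProfile s) (Set.Ioo (0 : ℝ) 1) J := by
  have hcont : ContinuousOn (precisionProfile s) (Set.Icc 0 1) := by
    refine ContinuousOn.div (ContinuousOn.pow (ContinuousOn.div (by fun_prop) (by fun_prop)
      fun J hJ => (precisionProfile_denominator_pos hs hJ).ne') 2) (by fun_prop) fun J _ => ?_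
    have := Real.sqrt_nonneg (1 - J ^ 2)
    positivity
  obtain ⟨J, hJ, hmax⟩ := isCompact_Icc.exists_isMaxOn (Set.nonempty_Icc.mpr zero_le_one) hcont
  have hhalf : 0 < precisionProfile s (1 / 2) := by
    have hF0 : 0 < √(1 - (1 / 2 : ℝ) ^ 2) := Real.sqrt_pos.mpr (by norm_num)
    unfold precisionProfile
    positivity
  have hpos : 0 < precisionProfile s J :=
    hhalf.trans_le (hmax (by norm_num : (1 / 2 : ℝ) ∈ Set.Icc (0 : ℝ) 1))
  -- the profile vanishes at both ends of the interval
  have h0 : J ≠ 0 := by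
    rintro rfl
    simp [precisionProfile] at hpos
  have h1 : J ≠ 1 := by
    rintro rfl
    simp [precisionProfile] at hpos
  exact ⟨J, ⟨lt_of_le_of_ne hJ.1 h0.symm, lt_of_le_of_ne hJ.2 h1⟩, hpos,
    hmax.on_subset Set.Ioo_subset_Icc_self⟩

end QubitCoupler

theorem mainTheorem5 (d : ℕ) (hd : 3 ≤ d) :
    -- the quantities of a single coupler
    (∀ J ∈ Set.Ioo (0 : ℝ) 1,
      (∀ b, QubitCoupler.couplerState J b =
        Matrix.vecMulVec (QubitCoupler.couplerGround J b)
          (star (QubitCoupler.couplerGround J b))) ∧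
      QubitCoupler.chi J = (J : ℂ) ∧
      QubitCoupler.overlap J = ((√(1 - J ^ 2) : ℝ) : ℂ)) ∧
    -- the ground space of the bare Hamiltonian, its gap and logical basis, and `i = 1`
    (∀ n : ℕ, 4 ≤ n → ∀ J ∈ Set.Ioo (0 : ℝ) 1,
      spectrum ℝ (QubitCoupler.bareHam n J) ⊆ {-(n : ℝ)} ∪ Set.Ici (-(n : ℝ) + 2) ∧
      (QubitCoupler.logicalBasis n J)ᴴ * QubitCoupler.logicalBasis n J = 1 ∧
      QubitCoupler.logicalBasis n J * (QubitCoupler.logicalBasis n J)ᴴ =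
        QubitCoupler.groundProj n J ∧
      ∀ i : Fin n, ‖QubitCoupler.groundProj n J *
        QubitCoupler.siteOp i (QubitCoupler.couplerOp QubitCoupler.pauliZ)‖ = 1) ∧
    -- the gadget works, at each `J`, for control errors up to the bound at that `J`
    (∀ n : ℕ, 4 ≤ n → ∀ ε : ℝ, 0 < ε → ε ≤ 7 / 16 → ∀ J ∈ Set.Ioo (0 : ℝ) 1, ∀ δ : ℝ,
      δ ≤ QubitCoupler.controlBound n ((d : ℝ) / 2) ε J →
      QubitCoupler.GadgetReproduces n d J ε δ) ∧
    -- the maximum over `J` is attained, is of order `1 / n`, and is an admissible error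
    (∃ J ∈ Set.Ioo (0 : ℝ) 1, ∃ C : ℝ, 0 < C ∧
      ∀ n : ℕ, 4 ≤ n → ∀ ε : ℝ, 0 < ε → ε ≤ 7 / 16 →
        IsMaxOn (QubitCoupler.controlBound n ((d : ℝ) / 2) ε) (Set.Ioo (0 : ℝ) 1) J ∧
        QubitCoupler.controlBound n ((d : ℝ) / 2) ε J = C * ε ^ 2 / n ∧
        ∀ δ : ℝ, δ ≤ QubitCoupler.controlBound n ((d : ℝ) / 2) ε J →
          QubitCoupler.GadgetReproduces n d J ε δ) := by
  have hs : (0 : ℝ) < (d : ℝ) / 2 := by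
    have : (0 : ℝ) < d := Nat.cast_pos.mpr (by omega)
    positivity
  refine ⟨fun J hJ => ⟨QubitCoupler.couplerState_eq hJ, QubitCoupler.chi_eq hJ,
    QubitCoupler.overlap_eq hJ⟩, fun n _ J hJ => ⟨QubitCoupler.spectrum_bareHam_subset n hJ,
    QubitCoupler.logicalBasis_conjTranspose_mul n hJ,
    QubitCoupler.logicalBasis_mul_conjTranspose n hJ,
    QubitCoupler.norm_groundProj_mul_siteOp n hJ⟩, fun n hn ε hε hε' J hJ δ hδ =>
    QubitCoupler.gadgetReproduces_of_le (by omega) (by omega) hε hε' hJ hδ, ?_⟩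
  obtain ⟨J, hJ, hpos, hmax⟩ := QubitCoupler.exists_isMaxOn_precisionProfile hs
  refine ⟨J, hJ, ((d : ℝ) / 2) ^ 2 * 0.95 / 84 * QubitCoupler.precisionProfile ((d : ℝ) / 2) J,
    by positivity, fun n hn ε hε hε' => ⟨fun J' hJ' => ?_,
    QubitCoupler.controlBound_eq_precisionProfile (by omega) hs hJ, fun δ hδ =>
    QubitCoupler.gadgetReproduces_of_le (by omega) (by omega) hε hε' hJ hδ⟩⟩
  have h : QubitCoupler.precisionProfile ((d : ℝ) / 2) J' ≤
      QubitCoupler.precisionProfile ((d : ℝ) / 2) J := hmax hJ'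
  change QubitCoupler.controlBound n ((d : ℝ) / 2) ε J' ≤
    QubitCoupler.controlBound n ((d : ℝ) / 2) ε J
  rw [QubitCoupler.controlBound_eq_precisionProfile (by omega) hs hJ',
    QubitCoupler.controlBound_eq_precisionProfile (by omega) hs hJ]
  gcongr
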